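/- Let $k$ be a field. For integers $x,y\ge 0$, let $Q(x,y)$ be the quiver with two vertices $1,2$, with $x$ arrows $\alpha_1,\dots,\alpha_x$ from $1$ to $2$ and $y$ arrows $\beta_1,\dots,\beta_y$ from $2$ to $1$. Let $B(x,y)$ be the quotient of the path algebra $kQ(x,y)$ by the two-sided ideal generated by the paths $\beta_q\alpha_p$ (first $\alpha_p$, then $\beta_q$) for $1\le p\le x$, $1\le q\le y$. For a $k$-algebra $A$ with enveloping algebra $A^e=A^{op}\otimes_k A$ and an integer $p$, let $HH^p(A)=\operatorname{Hom}_{\mathcal D(A^e)}(A,A[p])$ denote the $p$-th Hochschild cohomology of $A$, where $\mathcal D(A^e)$ is the unbounded derived category of $A^e$-modules. Then all the spaces $HH^p(B(x,y))$, $p\in\mathbb Z$, are finite-dimensional over $k$. If $x+y\ge 1$, then for every $p\in\mathbb Z$ $$\dim_k HH^p(B(x,y))=\begin{cases} xy+1 & p=0,\\ x^2+y^2-1 & p=1,\\ xy & p=2,\\ 0 & \text{otherwise,}\end{cases}$$ and for every $p\in\mathbb Z$ $$\dim_k HH^p(B(0,0))=\begin{cases} 2 & p=0,\\ 0 & \text{otherwise.}\end{cases}$$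 -/

import Mathlib

open CategoryTheory TensorProduct

universe u v w

noncomputable section

/-! ### Path algebras -/

/-- The underlying space of the path algebra `kQ` of a quiver `Q` with vertex type `V`:
the free `k`-module on the set of all paths (including the trivial paths). -/
def PathAlgebra (k : Type u) [Field k] (V : Type v) [Quiver.{w} V] : Type (max u v w) :=
  (Σ a : V, Σ b : V, Quiver.Path a b) →₀ k

namespace PathAlgebra

section Module

variable (k : Type u) [Field k] {V : Type v} [Quiver.{w} V]

instance : AddCommGroup (PathAlgebra k V) :=
  inferInstanceAs (AddCommGroup ((Σ a : V, Σ b : V, Quiver.Path a b) →₀ k))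

instance : Module k (PathAlgebra k V) :=
  inferInstanceAs (Module k ((Σ a : V, Σ b : V, Quiver.Path a b) →₀ k))

/-- A path, as an element of the path algebra. -/
def ofPath {a b : V} (p : Quiver.Path a b) : PathAlgebra k V :=
  Finsupp.single (⟨a, b, p⟩ : Σ a : V, Σ b : V, Quiver.Path a b) (1 : k)

variable {k}

/-- The linear extension of a family indexed by the paths. -/
def lift {M : Type*} [AddCommGroup M] [Module k M]
    (φ : (Σ a : V, Σ b : V, Quiver.Path a b) → M) : PathAlgebra k V →ₗ[k] M :=
  Finsupp.linearCombination k φ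

theorem lift_ofPath {M : Type*} [AddCommGroup M] [Module k M]
    (φ : (Σ a : V, Σ b : V, Quiver.Path a b) → M) {a b : V} (p : Quiver.Path a b) :
    lift φ (ofPath k p) = φ ⟨a, b, p⟩ :=
  (Finsupp.linearCombination_single k (1 : k) _).trans (one_smul k _)

theorem induction_on {P : PathAlgebra k V → Prop} (f : PathAlgebra k V)
    (zero : P 0) (add : ∀ f g, P f → P g → P (f + g)) (smul : ∀ (r : k) f, P f → P (r • f))
    (path : ∀ {a b : V} (p : Quiver.Path a b), P (ofPath k p)) : P f := by
  refine Finsupp.induction_linear (motive := fun g => P g) f zero add ?_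
  rintro ⟨a, b, p⟩ r
  have h : (Finsupp.single (⟨a, b, p⟩ : Σ a : V, Σ b : V, Quiver.Path a b) r) =
      r • Finsupp.single (⟨a, b, p⟩ : Σ a : V, Σ b : V, Quiver.Path a b) (1 : k) := by
    rw [Finsupp.smul_single, smul_eq_mul, mul_one]
  rw [h]
  exact smul r _ (path p)

end Module

section Mul

variable (k : Type u) [Field k] {V : Type v} [Quiver.{w} V] [DecidableEq V]

/-- The product `p q` of two paths: the path "first `q`, then `p`" if `q` ends where `p` starts,
and zero otherwise. -/
def mulPath (p q : Σ a : V, Σ b : V, Quiver.Path a b) : PathAlgebra k V :=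
  if h : q.2.1 = p.1 then ofPath k ((q.2.2.cast rfl h).comp p.2.2) else 0

/-- The bilinear extension of the multiplication of paths. -/
def mulHom : PathAlgebra k V →ₗ[k] PathAlgebra k V →ₗ[k] PathAlgebra k V :=
  lift fun p => lift fun q => mulPath k p q

instance : Mul (PathAlgebra k V) := ⟨fun f g => mulHom k f g⟩

theorem mul_def (f g : PathAlgebra k V) : f * g = mulHom k f g := rfl

theorem ofPath_mul_ofPath {a b c : V} (p : Quiver.Path b c) (q : Quiver.Path a b) :
    ofPath k p * ofPath k q = ofPath k (q.comp p) := by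
  rw [mul_def, mulHom, lift_ofPath, lift_ofPath, mulPath, dif_pos rfl]
  rfl

theorem ofPath_mul_ofPath_of_ne {a b c d : V} (p : Quiver.Path c d) (q : Quiver.Path a b)
    (h : b ≠ c) : ofPath k p * ofPath k q = 0 := by
  rw [mul_def, mulHom, lift_ofPath, lift_ofPath, mulPath, dif_neg h]

instance : NonUnitalNonAssocRing (PathAlgebra k V) where
  left_distrib f g h := by simp only [mul_def, map_add]
  right_distrib f g h := by simp only [mul_def, map_add, LinearMap.add_apply]
  zero_mul f := by simp only [mul_def, map_zero, LinearMap.zero_apply]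
  mul_zero f := by simp only [mul_def, map_zero]

theorem smul_mul' (r : k) (f g : PathAlgebra k V) : r • f * g = r • (f * g) := by
  simp only [mul_def, map_smul, LinearMap.smul_apply]

theorem mul_smul' (r : k) (f g : PathAlgebra k V) : f * r • g = r • (f * g) := by
  simp only [mul_def, map_smul]

theorem mul_assoc' (f g h : PathAlgebra k V) : f * g * h = f * (g * h) := by
  induction f using induction_on with
  | zero => simp only [zero_mul]
  | add f₁ f₂ h₁ h₂ => simp only [add_mul, h₁, h₂]
  | smul r f hf => simp only [smul_mul', hf]
  | @path c' d p =>
    induction g using induction_on with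
    | zero => simp only [zero_mul, mul_zero]
    | add f₁ f₂ h₁ h₂ => simp only [add_mul, mul_add, h₁, h₂]
    | smul r f hf => simp only [smul_mul', mul_smul', hf]
    | @path b' c q =>
      induction h using induction_on with
      | zero => simp only [mul_zero]
      | add f₁ f₂ h₁ h₂ => simp only [mul_add, h₁, h₂]
      | smul r f hf => simp only [mul_smul', hf]
      | @path a b s =>
        by_cases h₁ : c = c'
        · subst h₁
          by_cases h₂ : b = b'
          · subst h₂
            simp only [ofPath_mul_ofPath, Quiver.Path.comp_assoc]
          · rw [ofPath_mul_ofPath, ofPath_mul_ofPath_of_ne k _ _ h₂,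
              ofPath_mul_ofPath_of_ne k _ _ h₂, mul_zero]
        · rw [ofPath_mul_ofPath_of_ne k _ _ h₁, zero_mul]
          by_cases h₂ : b = b'
          · subst h₂
            rw [ofPath_mul_ofPath, ofPath_mul_ofPath_of_ne k _ _ h₁]
          · rw [ofPath_mul_ofPath_of_ne k _ _ h₂, mul_zero]

variable [Fintype V]

/-- The unit of the path algebra is the sum of the trivial paths. -/
instance : One (PathAlgebra k V) := ⟨∑ a : V, ofPath k (Quiver.Path.nil : Quiver.Path a a)⟩

theorem one_def : (1 : PathAlgebra k V) =
    ∑ a : V, ofPath k (Quiver.Path.nil : Quiver.Path a a) := rfl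

theorem one_mul' (f : PathAlgebra k V) : 1 * f = f := by
  induction f using induction_on with
  | zero => rw [mul_zero]
  | add f₁ f₂ h₁ h₂ => rw [mul_add, h₁, h₂]
  | smul r f hf => rw [mul_smul', hf]
  | @path a b p =>
    rw [one_def, Finset.sum_mul, Finset.sum_eq_single b]
    · rw [ofPath_mul_ofPath, Quiver.Path.comp_nil]
    · intro c _ hc
      exact ofPath_mul_ofPath_of_ne k _ _ hc.symm
    · intro h
      exact absurd (Finset.mem_univ b) h

theorem mul_one' (f : PathAlgebra k V) : f * 1 = f := by
  induction f using induction_on with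
  | zero => rw [zero_mul]
  | add f₁ f₂ h₁ h₂ => rw [add_mul, h₁, h₂]
  | smul r f hf => rw [smul_mul', hf]
  | @path a b p =>
    rw [one_def, Finset.mul_sum, Finset.sum_eq_single a]
    · rw [ofPath_mul_ofPath, Quiver.Path.nil_comp]
    · intro c _ hc
      exact ofPath_mul_ofPath_of_ne k _ _ hc
    · intro h
      exact absurd (Finset.mem_univ a) h

instance : Ring (PathAlgebra k V) where
  __ := (inferInstance : NonUnitalNonAssocRing (PathAlgebra k V))
  mul_assoc := mul_assoc' k
  one_mul := one_mul' k
  mul_one := mul_one' k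

instance : Algebra k (PathAlgebra k V) :=
  Algebra.ofModule (smul_mul' k) (fun r f g => mul_smul' k r f g)

end Mul

end PathAlgebra

/-! ### The algebras `B(x, y)` -/

/-- The two vertices `1` and `2` of the quiver `Q(x, y)`. -/
inductive TwoVertex (x y : ℕ) : Type
  | one : TwoVertex x y
  | two : TwoVertex x y
  deriving DecidableEq, Fintype

/-- The arrows of the quiver `Q(x, y)`: `x` arrows `α` from `1` to `2` and
`y` arrows `β` from `2` to `1`. -/
inductive TwoArrow (x y : ℕ) : TwoVertex x y → TwoVertex x y → Type
  | α (p : Fin x) : TwoArrow x y TwoVertex.one TwoVertex.two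
  | β (q : Fin y) : TwoArrow x y TwoVertex.two TwoVertex.one

instance (x y : ℕ) : Quiver (TwoVertex x y) where
  Hom a b := TwoArrow x y a b

namespace QHAlgebra

variable (k : Type u) [Field k] (x y : ℕ)

/-- The arrow `α_p` as an element of the path algebra of `Q(x, y)`. -/
def pathα (p : Fin x) : PathAlgebra k (TwoVertex x y) :=
  PathAlgebra.ofPath k
    (Quiver.Hom.toPath (TwoArrow.α p : (TwoVertex.one : TwoVertex x y) ⟶ TwoVertex.two))

/-- The arrow `β_q` as an element of the path algebra of `Q(x, y)`. -/
def pathβ (q : Fin y) : PathAlgebra k (TwoVertex x y) :=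
  PathAlgebra.ofPath k
    (Quiver.Hom.toPath (TwoArrow.β q : (TwoVertex.two : TwoVertex x y) ⟶ TwoVertex.one))

/-- The two-sided ideal of the path algebra of `Q(x, y)` generated by the paths `β_q α_p`
(first `α_p`, then `β_q`). -/
def relations : TwoSidedIdeal (PathAlgebra k (TwoVertex x y)) :=
  TwoSidedIdeal.span
    {f | ∃ (p : Fin x) (q : Fin y), f = pathβ k x y q * pathα k x y p}

end QHAlgebra

/-- The algebra `B(x, y)`: the path algebra of the quiver `Q(x, y)` modulo the two-sided ideal
generated by the paths `β_q α_p`. -/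
abbrev QHAlgebra (k : Type u) [Field k] (x y : ℕ) : Type u :=
  (QHAlgebra.relations k x y).ringCon.Quotient

/-! ### Hochschild cohomology -/

section Hochschild

attribute [local instance] HasDerivedCategory.standard

/-- The category of `A`-`A`-bimodules on which `k` acts centrally, as the category of modules
over the enveloping algebra `A ⊗ Aᵒᵖ`. (A left module over `A ⊗ Aᵒᵖ` is the same as a right
module over `Aᵒᵖ ⊗ A`.) -/
abbrev BimoduleCat (k : Type u) [Field k] (A : Type u) [Ring A] [Algebra k A] : Type (u + 1) :=
  ModuleCat.{u} (A ⊗[k] Aᵐᵒᵖ)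

/-- The regular bimodule `A`, where `a ⊗ b` acts by `c ↦ a * c * b`. -/
def regularBimodule (k : Type u) [Field k] (A : Type u) [Ring A] [Algebra k A] :
    BimoduleCat k A :=
  letI : Module (A ⊗[k] Aᵐᵒᵖ) A := instModuleTensorProductMop k A
  ModuleCat.of (A ⊗[k] Aᵐᵒᵖ) A

/-- The `p`-th Hochschild cohomology `HH^p(A)`, `p ∈ ℤ`, of a `k`-algebra `A`: the space of
morphisms `A ⟶ A[p]` in the (unbounded) derived category of `A`-`A`-bimodules. -/
def HochschildCohomology (k : Type u) [Field k] (A : Type u) [Ring A] [Algebra k A] (p : ℤ) :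
    Type (u + 1) :=
  (DerivedCategory.singleFunctor (BimoduleCat k A) 0).obj (regularBimodule k A) ⟶
    ((DerivedCategory.singleFunctor (BimoduleCat k A) 0).obj (regularBimodule k A))⟦p⟧

instance (k : Type u) [Field k] (A : Type u) [Ring A] [Algebra k A] (p : ℤ) :
    AddCommGroup (HochschildCohomology k A p) :=
  inferInstanceAs (AddCommGroup
    ((DerivedCategory.singleFunctor (BimoduleCat k A) 0).obj (regularBimodule k A) ⟶
      ((DerivedCategory.singleFunctor (BimoduleCat k A) 0).obj (regularBimodule k A))⟦p⟧))

/-- The `k`-vector space structure on `HH^p(A)` coming from the `k`-linear structure of the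
derived category. -/
instance (k : Type u) [Field k] (A : Type u) [Ring A] [Algebra k A] (p : ℤ) :
    Module k (HochschildCohomology k A p) :=
  inferInstanceAs (Module k
    ((DerivedCategory.singleFunctor (BimoduleCat k A) 0).obj (regularBimodule k A) ⟶
      ((DerivedCategory.singleFunctor (BimoduleCat k A) 0).obj (regularBimodule k A))⟦p⟧))

end Hochschild

end

/-! Write `A` for `B(x, y)`. Products of paths are read from right to left, so `α_p` lies in `e₂ A
e₁`, `β_q` in `e₁ A e₂`, and `A` has the basis `e₁, e₂, α_p, β_q, α_p β_q`. The relations `β_q α_p`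
are quadratic monomials that do not overlap one another, so the bimodule `A` has a projective
resolution of length two, `0 → P₂ → P₁ → P₀ → A → 0`. Here `P₀` is the sum of `A e_v ⊗ e_v A` over
the vertices, `P₁` the sum of `A e₂ ⊗ e₁ A` over the `α_p` and `A e₁ ⊗ e₂ A` over the `β_q`, and
`P₂` the sum of `A e₁ ⊗ e₁ A` over the relations. Exactness is witnessed by an explicit contracting
homotopy (`homotopy₀`, `homotopy₁`, `homotopy₂`).

A bimodule map from `A l ⊗ r A` to `A` is an element of the corner `l A r`. The corners have
dimensions `1` (`e₁ A e₁`), `xy + 1` (`e₂ A e₂`), `x` (`e₂ A e₁`) and `y` (`e₁ A e₂`), so the three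
Hom spaces have dimensions `xy + 2`, `x² + y²` and `xy`. The second coboundary sends `(u_p, w_q)` to
`β_q u_p + w_q α_p`, which vanishes because `β_q A e₁ = 0` and `e₁ A α_p = 0` (`comp_d₂_eq_zero`).
Hence `HH²` has dimension `xy`, `HH⁰` is the center, of dimension `z` say, and an Euler
characteristic count gives `z + x² + y² - (xy + 2)` for `HH¹`. The center is spanned by `1` and the
`α_p β_q` once there is an arrow, so `z = xy + 1`; for `x = y = 0` it is all of `A = k × k`, so `z =
2`.

That the quotient of the path algebra really has the stated basis is shown by a multiplicative
coordinate map that kills the relations (`coordinates_mul`, `coordinates_eq_zero`). -/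

noncomputable section

/-! ### Dimensions of Ext groups from a projective resolution of length two. -/

namespace CategoryTheory.Abelian.Ext

variable {k : Type u} [Field k] {C : Type v} [Category.{w} C] [Abelian C] [Linear k C]

section
universe w'
variable [HasExt.{w'} C]

/-- Dimension shifting along a short exact sequence whose middle term is projective. -/
theorem nonempty_linearEquiv_succ {S : ShortComplex C} (hS : S.ShortExact) [Projective S.X₂]
    (Y : C) (n : ℕ) : Nonempty (Ext S.X₁ Y (n + 1) ≃ₗ[k] Ext S.X₃ Y (n + 2)) := by
  refine ⟨LinearEquiv.ofBijective
    (hS.extClass.precompOfLinear k Y (show 1 + (n + 1) = n + 2 by omega)) ⟨?_, ?_⟩⟩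
  · rw [injective_iff_map_eq_zero]
    intro z hz
    obtain ⟨y, rfl⟩ := contravariant_sequence_exact₁ hS Y z (by omega) hz
    rw [y.eq_zero_of_projective, comp_zero]
  · intro z
    exact contravariant_sequence_exact₃ hS Y z (eq_zero_of_projective _) (by omega)

/-- The beginning of the long exact sequence of a short exact sequence
whose middle term is projective, in terms of dimensions. -/
theorem finrank_one {S : ShortComplex C} (hS : S.ShortExact) [Projective S.X₂] (Y : C)
    [Module.Finite k (S.X₂ ⟶ Y)] [Module.Finite k (S.X₁ ⟶ Y)] :
    Module.Finite k (S.X₃ ⟶ Y) ∧ Module.Finite k (Ext S.X₃ Y 1) ∧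
    Module.finrank k (Ext S.X₃ Y 1) + Module.finrank k (S.X₂ ⟶ Y) =
      Module.finrank k (S.X₃ ⟶ Y) + Module.finrank k (S.X₁ ⟶ Y) := by
  let a : (S.X₃ ⟶ Y) →ₗ[k] (S.X₂ ⟶ Y) := Linear.leftComp k Y S.g
  let b : (S.X₂ ⟶ Y) →ₗ[k] (S.X₁ ⟶ Y) := Linear.leftComp k Y S.f
  let c : (S.X₁ ⟶ Y) →ₗ[k] Ext S.X₃ Y 1 :=
    (hS.extClass.precompOfLinear k Y (show 1 + 0 = 1 from rfl)).comp
      (linearEquiv₀ (R := k)).symm.toLinearMap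
  have ha : Function.Injective a := by
    have := hS.epi_g
    intro f g h
    exact (cancel_epi S.g).1 h
  have hab : LinearMap.range a = LinearMap.ker b := by
    ext f
    constructor
    · rintro ⟨g, rfl⟩
      simp [a, b]
    · intro hf
      have := hS.epi_g
      exact ⟨hS.exact.desc f hf, hS.exact.g_desc f hf⟩
  have hbc : LinearMap.range b = LinearMap.ker c := by
    ext f
    constructor
    · rintro ⟨g, rfl⟩
      simp only [LinearMap.mem_ker, c, b, LinearMap.comp_apply, LinearEquiv.coe_coe,
        linearEquiv₀_symm_apply, Linear.leftComp_apply, bilinearCompOfLinear_apply_apply]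
      change hS.extClass.comp (mk₀ _) _ = 0
      rw [← mk₀_comp_mk₀, hS.extClass_comp_assoc]
    · intro hf
      obtain ⟨y, hy⟩ := contravariant_sequence_exact₁ hS Y _ (show 1 + 0 = 1 from rfl) hf
      obtain ⟨g, rfl⟩ := (linearEquiv₀ (R := k)).symm.surjective y
      refine ⟨g, (linearEquiv₀ (R := k)).symm.injective ?_⟩
      refine Eq.trans ?_ hy
      exact (mk₀_comp_mk₀ _ _).symm
  have hc : Function.Surjective c := by
    intro z
    obtain ⟨y, hy⟩ := contravariant_sequence_exact₃ hS Y z (eq_zero_of_projective _)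
      (show 1 + 0 = 1 from rfl)
    exact ⟨linearEquiv₀ (R := k) y, by simpa [c] using hy⟩
  refine ⟨Module.Finite.of_injective a ha, Module.Finite.of_surjective c hc, ?_⟩
  have h₁ := b.finrank_range_add_finrank_ker
  have h₂ := c.finrank_range_add_finrank_ker
  rw [← hab, LinearMap.finrank_range_of_inj ha] at h₁
  rw [← hbc, LinearMap.range_eq_top.2 hc, finrank_top] at h₂
  omega

end

/-- Morphisms in the derived category from an object with a projective resolution of length two
for which the second coboundary vanishes. -/
theorem finrank_hom_shift_of_resolution [HasDerivedCategory C] {S T : ShortComplex C}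
    (hS : S.ShortExact) (hT : T.ShortExact) (e : T.X₃ ≅ S.X₁)
    [Projective S.X₂] [Projective T.X₂] [Projective T.X₁] (Y : C)
    [Module.Finite k (S.X₂ ⟶ Y)] [Module.Finite k (T.X₂ ⟶ Y)] [Module.Finite k (T.X₁ ⟶ Y)]
    (hd : ∀ f : T.X₂ ⟶ Y, T.f ≫ f = 0) (p : ℤ) :
    let H := ((DerivedCategory.singleFunctor C 0).obj S.X₃ ⟶
      ((DerivedCategory.singleFunctor C 0).obj Y)⟦p⟧)
    Module.Finite k H ∧ (Module.finrank k H : ℤ) =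
      if p = 0 then (Module.finrank k (S.X₃ ⟶ Y) : ℤ)
      else if p = 1 then (Module.finrank k (S.X₃ ⟶ Y) : ℤ) + Module.finrank k (T.X₂ ⟶ Y)
        - Module.finrank k (S.X₂ ⟶ Y)
      else if p = 2 then (Module.finrank k (T.X₁ ⟶ Y) : ℤ)
      else 0 := by
  intro H
  obtain hp | ⟨n, rfl⟩ : p < 0 ∨ ∃ n : ℕ, p = n :=
    (lt_or_ge p 0).imp id fun h => ⟨p.toNat, by omega⟩
  · have : Subsingleton H := ⟨fun f g => by
      -- `Y[p]` is concentrated in degree `-p > 0` and the source in degree `0`, so the t-structure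
      -- leaves only the zero map.
      have hY := DerivedCategory.TStructure.t.isGE_shift
        ((DerivedCategory.singleFunctor C 0).obj Y) 0 p (-p) (by omega)
      have h0 (f : H) : f = 0 :=
        DerivedCategory.TStructure.t.zero f 0 (-p) (by omega)
      rw [h0 f, h0 g]⟩
    refine ⟨inferInstance, ?_⟩
    rw [Module.finrank_zero_of_subsingleton, if_neg (by omega), if_neg (by omega),
      if_neg (by omega)]
    rfl
  · have := HasExt.standard C
    let E (n : ℕ) : Ext S.X₃ Y n ≃ₗ[k] ((DerivedCategory.singleFunctor C 0).obj S.X₃ ⟶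
      ((DerivedCategory.singleFunctor C 0).obj Y)⟦(n : ℤ)⟧) := homLinearEquiv
    obtain ⟨hTf, hT₁f, hT₁⟩ := finrank_one (k := k) hT Y
    let e' : (T.X₃ ⟶ Y) ≃ₗ[k] (S.X₁ ⟶ Y) := Linear.homCongr k e (Iso.refl Y)
    have : Module.Finite k (S.X₁ ⟶ Y) := Module.Finite.equiv e'
    -- By `hd` every map `T.X₂ ⟶ Y` kills `T.f`, so it factors through the cokernel `T.X₃`.
    have hTr : Module.finrank k (T.X₃ ⟶ Y) = Module.finrank k (T.X₂ ⟶ Y) := by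
      refine LinearEquiv.finrank_eq (LinearEquiv.ofBijective (Linear.leftComp k Y T.g) ⟨?_, ?_⟩)
      · have := hT.epi_g
        intro f g h
        exact (cancel_epi T.g).1 h
      · intro f
        have := hT.epi_g
        exact ⟨hT.exact.desc f (hd f), hT.exact.g_desc f (hd f)⟩
    obtain ⟨hSf, hS₁f, hS₁⟩ := finrank_one (k := k) hS Y
    have he := e'.finrank_eq
    suffices Module.Finite k (Ext S.X₃ Y n) ∧ (Module.finrank k (Ext S.X₃ Y n) : ℤ) = _ from
      ⟨this.1.equiv (E n), (E n).finrank_eq ▸ this.2⟩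
    let f (n : ℕ) : Ext T.X₃ Y n ≃ₗ[k] Ext S.X₁ Y n :=
      { toFun := fun x => (mk₀ e.inv).comp x (zero_add n)
        invFun := fun x => (mk₀ e.hom).comp x (zero_add n)
        map_add' := by simp
        map_smul' := by simp
        left_inv := fun x => by simp
        right_inv := fun x => by simp }
    match n with
    | 0 =>
      let g : Ext S.X₃ Y 0 ≃ₗ[k] (S.X₃ ⟶ Y) := linearEquiv₀
      refine ⟨Module.Finite.equiv g.symm, ?_⟩
      rw [g.finrank_eq]
      simp
    | 1 =>
      refine ⟨hS₁f, ?_⟩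
      simp only [Nat.cast_one, one_ne_zero, if_false, if_true]
      omega
    | 2 =>
      -- `Ext²(S.X₃, Y) ≅ Ext¹(T.X₃, Y)`, and by `hT₁` and `hTr` the latter has the dimension of
      -- `Hom(T.X₁, Y)`.
      obtain ⟨g⟩ := nonempty_linearEquiv_succ (k := k) hS Y 0
      refine ⟨Module.Finite.equiv ((f 1).trans g), ?_⟩
      rw [← ((f 1).trans g).finrank_eq]
      norm_num
      omega
    | n + 3 =>
      -- Shifting along both sequences lands in `Ext^(n+1)(T.X₁, Y)`, which is zero as `T.X₁` is
      -- projective.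
      obtain ⟨g⟩ := nonempty_linearEquiv_succ (k := k) hS Y (n + 1)
      obtain ⟨g'⟩ := nonempty_linearEquiv_succ (k := k) hT Y n
      have : Subsingleton (Ext T.X₁ Y (n + 1)) := subsingleton_of_projective _ _ _
      have : Subsingleton (Ext S.X₃ Y (n + 3)) :=
        ((g'.trans (f _)).trans g).symm.injective.subsingleton
      refine ⟨inferInstance, ?_⟩
      rw [Module.finrank_zero_of_subsingleton, if_neg (by omega), if_neg (by omega),
        if_neg (by omega)]
      rfl

end CategoryTheory.Abelian.Ext

open MulOpposite

/-! ### Projective modules defined by families of idempotents -/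

section IdempotentModule

variable {R : Type*} [Ring R] {ι : Type*}

/-- The direct sum of the left ideals `R (f i)`, for a family of idempotents `f i`, as a submodule
of a free module. -/
def idempotentModule (f : ι → R) : Submodule R (ι → R) where
  carrier := {t | ∀ i, t i * f i = t i}
  add_mem' h₁ h₂ i := by simp only [Pi.add_apply, add_mul, h₁ i, h₂ i]
  zero_mem' i := zero_mul _
  smul_mem' r t h i := by simp only [Pi.smul_apply, smul_eq_mul, mul_assoc, h i]

theorem single_mem_idempotentModule [DecidableEq ι] {f : ι → R} {i : ι} {r : R}
    (h : r * f i = r) : (Pi.single i r : ι → R) ∈ idempotentModule f := by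
  intro j
  obtain rfl | hj := eq_or_ne j i
  · simpa using h
  · simp [hj]

/-- The projection of the free module on the summand `idempotentModule f`. -/
def idempotentModule.proj {f : ι → R} (hf : ∀ i, f i * f i = f i) :
    (ι → R) →ₗ[R] idempotentModule f where
  toFun t := ⟨fun i => t i * f i, fun i => by rw [mul_assoc, hf]⟩
  map_add' s t := by ext i; simp [add_mul]
  map_smul' r t := by ext i; simp [mul_assoc]

theorem idempotentModule.projective [Finite ι] {f : ι → R} (hf : ∀ i, f i * f i = f i) :
    Module.Projective R (idempotentModule f) :=
  Module.Projective.of_split (idempotentModule f).subtype (idempotentModule.proj hf) (by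
    ext t i
    exact t.2 i)

theorem smul_single_eq [DecidableEq ι] (r s : R) (i : ι) :
    r • (Pi.single i s : ι → R) = Pi.single i (r * s) :=
  (Pi.single_smul (f := fun _ => R) i r s).symm

variable [Fintype ι]

theorem linearCombination_mem {M : Type*} [AddCommGroup M] [Module R M] (N : Submodule R M)
    {n : ι → M} (hn : ∀ i, n i ∈ N) (t : ι → R) : Fintype.linearCombination R n t ∈ N := by
  rw [Fintype.linearCombination_apply]
  exact N.sum_mem fun i _ => N.smul_mem _ (hn i)

/-- The linear map between modules of the form `idempotentModule f` given by a matrix. -/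
def idempotentModule.map {κ : Type*} (f : ι → R) (g : κ → R) (n : ι → κ → R)
    (hn : ∀ i, n i ∈ idempotentModule g) : idempotentModule f →ₗ[R] idempotentModule g :=
  ((Fintype.linearCombination R n).comp (idempotentModule f).subtype).codRestrict _
    fun t => linearCombination_mem _ hn t

variable [DecidableEq ι]

theorem idempotentModule.sum_smul_single {f : ι → R} {t : ι → R} (ht : t ∈ idempotentModule f) :
    ∑ i, t i • (Pi.single i (f i) : ι → R) = t := by
  ext j
  rw [Finset.sum_apply, Finset.sum_eq_single j]
  · simpa using ht j
  · intro i _ hi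
    simp [hi.symm]
  · simp

end IdempotentModule

/-! ### Bimodules -/

section Bimodule

variable {k : Type u} [Field k] {A : Type u} [Ring A] [Algebra k A]

attribute [local instance] instModuleTensorProductMop

theorem tmul_op_smul (a b c : A) : (a ⊗ₜ[k] op b : A ⊗[k] Aᵐᵒᵖ) • c = a * c * b :=
  AlgHom.mulLeftRight_apply k A a (op b) c

theorem tmul_op_mul_tmul_op (a b c d : A) :
    (a ⊗ₜ[k] op b : A ⊗[k] Aᵐᵒᵖ) * (c ⊗ₜ op d) = (a * c) ⊗ₜ op (d * b) := by
  rw [Algebra.TensorProduct.tmul_mul_tmul, op_mul]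

theorem algebraMap_enveloping_smul (r : k) (c : A) :
    algebraMap k (A ⊗[k] Aᵐᵒᵖ) r • c = r • c := by
  rw [Algebra.TensorProduct.algebraMap_apply, ← op_one, tmul_op_smul, mul_one, Algebra.smul_def]

/-- The space `l A r`, for idempotents `l` and `r`. -/
def corner (k : Type u) [Field k] {A : Type u} [Ring A] [Algebra k A] (l r : A) :
    Submodule k A where
  carrier := {a | l * a * r = a}
  add_mem' h₁ h₂ := by
    simp only [Set.mem_ofPred_eq, mul_add, add_mul] at *
    rw [h₁, h₂]
  zero_mem' := by simp
  smul_mem' c a h := by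
    simp only [Set.mem_ofPred_eq, mul_smul_comm, smul_mul_assoc] at *
    rw [h]

theorem mem_corner {l r a : A} : a ∈ corner k l r ↔ l * a * r = a := Iff.rfl

variable {ι : Type} [DecidableEq ι]

/-- The family of idempotents `l i ⊗ r i` of the enveloping algebra. -/
abbrev envelopingIdempotent (k : Type u) [Field k] {A : Type u} [Ring A] [Algebra k A]
    {ι : Type} (l r : ι → A) (i : ι) : A ⊗[k] Aᵐᵒᵖ := l i ⊗ₜ op (r i)

/-- The projective bimodule `⨁ i, A (l i) ⊗ (r i) A`. -/
abbrev projBimodule (k : Type u) [Field k] {A : Type u} [Ring A] [Algebra k A]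
    {ι : Type} (l r : ι → A) : Submodule (A ⊗[k] Aᵐᵒᵖ) (ι → A ⊗[k] Aᵐᵒᵖ) :=
  idempotentModule (envelopingIdempotent k l r)

/-- The standard generators of `⨁ i, A (l i) ⊗ (r i) A`. -/
def projBimodule.gen {l r : ι → A} (hl : ∀ i, l i * l i = l i) (hr : ∀ i, r i * r i = r i)
    (i : ι) : projBimodule k l r :=
  ⟨Pi.single i (envelopingIdempotent k l r i),
    single_mem_idempotentModule (by rw [tmul_op_mul_tmul_op, hl, hr])⟩

theorem projBimodule.apply_gen_mem {l r : ι → A} (hl : ∀ i, l i * l i = l i)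
    (hr : ∀ i, r i * r i = r i) (φ : projBimodule k l r →ₗ[A ⊗[k] Aᵐᵒᵖ] A) (i : ι) :
    φ (gen hl hr i) ∈ corner k (l i) (r i) := by
  rw [mem_corner, ← tmul_op_smul (k := k), ← map_smul]
  congr 1
  ext1
  refine (smul_single_eq _ _ _).trans ?_
  rw [tmul_op_mul_tmul_op, hl, hr]
  rfl

variable [Fintype ι]

theorem projBimodule.sum_smul_gen {l r : ι → A} (hl : ∀ i, l i * l i = l i)
    (hr : ∀ i, r i * r i = r i) (t : projBimodule k l r) :
    ∑ i, t.1 i • gen (k := k) hl hr i = t := by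
  ext1
  rw [Submodule.coe_sum]
  exact idempotentModule.sum_smul_single t.2

/-- The homomorphism from `⨁ i, A (l i) ⊗ (r i) A` to `A` with given values on the generators. -/
def projBimodule.desc (l r : ι → A) (c : ι → A) : projBimodule k l r →ₗ[A ⊗[k] Aᵐᵒᵖ] A :=
  (Fintype.linearCombination (A ⊗[k] Aᵐᵒᵖ) c).comp (projBimodule k l r).subtype

/-- Bimodule homomorphisms from `⨁ i, A (l i) ⊗ (r i) A` to `A`. -/
def projBimoduleHomEquiv {l r : ι → A} (hl : ∀ i, l i * l i = l i) (hr : ∀ i, r i * r i = r i) :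
    (ModuleCat.of (A ⊗[k] Aᵐᵒᵖ) (projBimodule k l r) ⟶ regularBimodule k A) ≃ₗ[k]
      (∀ i, corner k (l i) (r i)) where
  toFun φ i := ⟨(φ.hom : projBimodule k l r →ₗ[A ⊗[k] Aᵐᵒᵖ] A) (projBimodule.gen hl hr i),
    projBimodule.apply_gen_mem hl hr φ.hom i⟩
  map_add' φ ψ := rfl
  map_smul' c φ := by
    ext i
    exact algebraMap_enveloping_smul c _
  invFun c := ModuleCat.ofHom (projBimodule.desc l r fun i => (c i : A))
  left_inv φ := by
    ext t
    let ψ : projBimodule k l r →ₗ[A ⊗[k] Aᵐᵒᵖ] A := φ.hom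
    change projBimodule.desc l r (fun i => ψ (projBimodule.gen hl hr i)) t = ψ t
    conv_rhs => rw [← projBimodule.sum_smul_gen hl hr t, map_sum]
    exact Finset.sum_congr rfl fun i _ => (map_smul ψ _ _).symm
  right_inv c := by
    ext i
    refine (Fintype.linearCombination_apply_single (A ⊗[k] Aᵐᵒᵖ) _ _ _).trans ?_
    rw [tmul_op_smul]
    exact (c i).2

/-- Linear maps which agree on suitable generators agree on `⨁ i, A (l i) ⊗ (r i) A`. -/
theorem eqOn_projBimodule {κ : Type*} (b : Module.Basis κ k A) (l r : ι → A) {N : Type*}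
    [AddCommGroup N] [Module k N] (F G : (ι → A ⊗[k] Aᵐᵒᵖ) →ₗ[k] N)
    (h : ∀ i j c, F (Pi.single i ((b j * l i) ⊗ₜ op (r i * c))) =
      G (Pi.single i ((b j * l i) ⊗ₜ op (r i * c)))) {t : ι → A ⊗[k] Aᵐᵒᵖ}
    (ht : t ∈ projBimodule k l r) : F t = G t := by
  have key (i : ι) (s : A ⊗[k] Aᵐᵒᵖ) : F (Pi.single i (s * envelopingIdempotent k l r i)) =
      G (Pi.single i (s * envelopingIdempotent k l r i)) := by
    induction s with
    | zero => simp
    | add s₁ s₂ h₁ h₂ => simp only [add_mul, Pi.single_add, map_add, h₁, h₂]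
    | tmul a c =>
      induction b.mem_span a using Submodule.span_induction with
      | zero => simp
      | add a₁ a₂ _ _ h₁ h₂ => simp only [add_tmul, add_mul, Pi.single_add, map_add, h₁, h₂]
      | smul z a _ ha =>
        rw [← smul_tmul', smul_mul_assoc, Pi.single_smul, map_smul, map_smul, ha]
      | mem a ha =>
        obtain ⟨j, rfl⟩ := ha
        rw [show b j ⊗ₜ c * envelopingIdempotent k l r i = _ from
          tmul_op_mul_tmul_op (b j) c.unop (l i) (r i)]
        exact h i j c.unop
  rw [← idempotentModule.sum_smul_single ht, map_sum, map_sum]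
  refine Finset.sum_congr rfl fun i _ => ?_
  rw [smul_single_eq]
  exact key i (t i)

end Bimodule

/-! ### The bimodule resolution and its contracting homotopy, in terms of a basis. -/

/-- The paths of length at most two which form a basis of `B(x, y)`. -/
inductive QHIndex (x y : ℕ) : Type
  | e₁ : QHIndex x y
  | e₂ : QHIndex x y
  | α (p : Fin x) : QHIndex x y
  | β (q : Fin y) : QHIndex x y
  | αβ (p : Fin x) (q : Fin y) : QHIndex x y
  deriving DecidableEq, Fintype

namespace QHIndex

variable {x y : ℕ}

/-- The multiplication table of `B(x, y)`, where `none` stands for zero. -/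
def mul : QHIndex x y → QHIndex x y → Option (QHIndex x y)
  | e₁, e₁ => some e₁
  | e₁, β q => some (β q)
  | e₂, e₂ => some e₂
  | e₂, α p => some (α p)
  | e₂, αβ p q => some (αβ p q)
  | α p, e₁ => some (α p)
  | α p, β q => some (αβ p q)
  | β q, e₂ => some (β q)
  | αβ p q, e₂ => some (αβ p q)
  | _, _ => none

end QHIndex

/-- A basis of an algebra with the multiplication table of `B(x, y)`. -/
structure QHBasis (k : Type u) [Field k] (A : Type u) [Ring A] [Algebra k A] (x y : ℕ) where
  /-- The underlying basis. -/
  basis : Module.Basis (QHIndex x y) k A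
  mul_eq : ∀ i j, basis i * basis j = (QHIndex.mul i j).elim 0 basis
  one_eq : basis .e₁ + basis .e₂ = 1

namespace QHBasis

variable {k : Type u} [Field k] {A : Type u} [Ring A] [Algebra k A] {x y : ℕ} (B : QHBasis k A x y)

attribute [local instance] instModuleTensorProductMop

open QHIndex

/-- The left and right idempotents of the resolution in degree zero. -/
def v₀ : TwoVertex x y → A
  | TwoVertex.one => B.basis e₁
  | TwoVertex.two => B.basis e₂

/-- The left idempotents of the resolution in degree one. -/
def l₁ : Fin x ⊕ Fin y → A
  | .inl _ => B.basis e₂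
  | .inr _ => B.basis e₁

/-- The right idempotents of the resolution in degree one. -/
def r₁ : Fin x ⊕ Fin y → A
  | .inl _ => B.basis e₁
  | .inr _ => B.basis e₂

/-- The left and right idempotents of the resolution in degree two. -/
def v₂ : Fin x × Fin y → A := fun _ => B.basis e₁

/-- The matrix of the first differential. -/
def n₁ : Fin x ⊕ Fin y → TwoVertex x y → A ⊗[k] Aᵐᵒᵖ
  | .inl p => Pi.single TwoVertex.one (B.basis (α p) ⊗ₜ op (B.basis e₁)) -
      Pi.single TwoVertex.two (B.basis e₂ ⊗ₜ op (B.basis (α p)))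
  | .inr q => Pi.single TwoVertex.two (B.basis (β q) ⊗ₜ op (B.basis e₂)) -
      Pi.single TwoVertex.one (B.basis e₁ ⊗ₜ op (B.basis (β q)))

/-- The matrix of the second differential. -/
def n₂ (i : Fin x × Fin y) : Fin x ⊕ Fin y → A ⊗[k] Aᵐᵒᵖ :=
  Pi.single (Sum.inl i.1) (B.basis (β i.2) ⊗ₜ op (B.basis e₁)) +
    Pi.single (Sum.inr i.2) (B.basis e₁ ⊗ₜ op (B.basis (α i.1)))

theorem v₀_mul (i : TwoVertex x y) : B.v₀ i * B.v₀ i = B.v₀ i := by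
  cases i <;> simp [v₀, B.mul_eq, QHIndex.mul]

theorem l₁_mul (i : Fin x ⊕ Fin y) : B.l₁ i * B.l₁ i = B.l₁ i := by
  cases i <;> simp [l₁, B.mul_eq, QHIndex.mul]

theorem r₁_mul (i : Fin x ⊕ Fin y) : B.r₁ i * B.r₁ i = B.r₁ i := by
  cases i <;> simp [r₁, B.mul_eq, QHIndex.mul]

theorem v₂_mul (i : Fin x × Fin y) : B.v₂ i * B.v₂ i = B.v₂ i := by
  simp [v₂, B.mul_eq, QHIndex.mul]

theorem n₁_mem (i : Fin x ⊕ Fin y) : B.n₁ i ∈ projBimodule k B.v₀ B.v₀ := by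
  cases i <;>
  · refine Submodule.sub_mem _ (single_mem_idempotentModule ?_) (single_mem_idempotentModule ?_) <;>
    simp [-op_mul, ← op_mul, envelopingIdempotent, v₀, B.mul_eq, QHIndex.mul]

theorem n₂_mem (i : Fin x × Fin y) : B.n₂ i ∈ projBimodule k B.l₁ B.r₁ := by
  refine Submodule.add_mem _ (single_mem_idempotentModule ?_) (single_mem_idempotentModule ?_) <;>
  simp [-op_mul, ← op_mul, envelopingIdempotent, l₁, r₁, B.mul_eq, QHIndex.mul]

/-- The augmentation of the free modules. -/
def D₀ : (TwoVertex x y → A ⊗[k] Aᵐᵒᵖ) →ₗ[A ⊗[k] Aᵐᵒᵖ] A :=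
  Fintype.linearCombination _ B.v₀

/-- The first differential of the free modules. -/
def D₁ : (Fin x ⊕ Fin y → A ⊗[k] Aᵐᵒᵖ) →ₗ[A ⊗[k] Aᵐᵒᵖ] (TwoVertex x y → A ⊗[k] Aᵐᵒᵖ) :=
  Fintype.linearCombination _ B.n₁

/-- The second differential of the free modules. -/
def D₂ : (Fin x × Fin y → A ⊗[k] Aᵐᵒᵖ) →ₗ[A ⊗[k] Aᵐᵒᵖ] (Fin x ⊕ Fin y → A ⊗[k] Aᵐᵒᵖ) :=
  Fintype.linearCombination _ B.n₂

/-- The linear map `b ↦ a ⊗ (c * b)` to a component of a free bimodule. -/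
def put {ι : Type} [DecidableEq ι] (i : ι) (a c : A) : Aᵐᵒᵖ →ₗ[k] (ι → A ⊗[k] Aᵐᵒᵖ) :=
  (LinearMap.single k _ i).comp ((TensorProduct.mk k A Aᵐᵒᵖ a).comp (LinearMap.mulRight k (op c)))

theorem put_apply {ι : Type} [DecidableEq ι] (i : ι) (a b c : A) :
    put (k := k) i a c (op b) = Pi.single i (a ⊗ₜ op (c * b)) := rfl

/-- The contracting homotopy in degree zero. -/
def s₀ : A →ₗ[k] (TwoVertex x y → A ⊗[k] Aᵐᵒᵖ) :=
  (put TwoVertex.one (B.basis e₁) (B.basis e₁) + put TwoVertex.two (B.basis e₂) (B.basis e₂)).comp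
    (opLinearEquiv k).toLinearMap

theorem s₀_apply (b : A) : B.s₀ b = Pi.single TwoVertex.one (B.basis e₁ ⊗ₜ op (B.basis e₁ * b)) +
    Pi.single TwoVertex.two (B.basis e₂ ⊗ₜ op (B.basis e₂ * b)) := rfl

/-- Values on the basis of the contracting homotopy in degree one. -/
def h₁ : QHIndex x y → Aᵐᵒᵖ →ₗ[k] (Fin x ⊕ Fin y → A ⊗[k] Aᵐᵒᵖ)
  | .α p => put (Sum.inl p) (B.basis e₂) (B.basis e₁)
  | .β q => put (Sum.inr q) (B.basis e₁) (B.basis e₂)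
  -- One term for each arrow of the path, `u a v` giving `u ⊗ v` in the component of `a`; under `D₁`
  -- the terms telescope.
  | .αβ p q => put (Sum.inl p) (B.basis e₂) (B.basis (β q)) +
      put (Sum.inr q) (B.basis (α p)) (B.basis e₂)
  | _ => 0

/-- The contracting homotopy in degree one. -/
def s₁ : (TwoVertex x y → A ⊗[k] Aᵐᵒᵖ) →ₗ[k] (Fin x ⊕ Fin y → A ⊗[k] Aᵐᵒᵖ) :=
  -- The component index can be forgotten: on `projBimodule` it is the source of the left tensor
  -- factor.
  (TensorProduct.lift (B.basis.constr k B.h₁)).comp (∑ i, LinearMap.proj i)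

theorem s₁_single (i : TwoVertex x y) (j : QHIndex x y) (b : A) :
    B.s₁ (Pi.single i (B.basis j ⊗ₜ op b)) = B.h₁ j (op b) := by
  simp [s₁]

/-- Values on the basis of the contracting homotopy in degree two. -/
def h₂ (p : Fin x) : QHIndex x y → Aᵐᵒᵖ →ₗ[k] (Fin x × Fin y → A ⊗[k] Aᵐᵒᵖ)
  -- In the component of `α_p`, a left factor ending in `β_q` meets the relation `β_q α_p`; the
  -- homotopy strips off that `β_q`.
  | .β q => put (p, q) (B.basis e₁) (B.basis e₁)
  | .αβ r q => put (p, q) (B.basis (α r)) (B.basis e₁)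
  | _ => 0

/-- The contracting homotopy in degree two. -/
def s₂ : (Fin x ⊕ Fin y → A ⊗[k] Aᵐᵒᵖ) →ₗ[k] (Fin x × Fin y → A ⊗[k] Aᵐᵒᵖ) :=
  ∑ p, (TensorProduct.lift (B.basis.constr k (B.h₂ p))).comp (LinearMap.proj (Sum.inl p))

theorem s₂_single_inl (p : Fin x) (j : QHIndex x y) (b : A) :
    B.s₂ (Pi.single (Sum.inl p) (B.basis j ⊗ₜ op b)) = B.h₂ p j (op b) := by
  rw [s₂, LinearMap.sum_apply, Finset.sum_eq_single p]
  · simp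
  · intro q _ hq
    simp [hq]
  · simp

theorem s₂_single_inr (q : Fin y) (t : A ⊗[k] Aᵐᵒᵖ) : B.s₂ (Pi.single (Sum.inr q) t) = 0 := by
  rw [s₂, LinearMap.sum_apply]
  simp

theorem D₀_single (i : TwoVertex x y) (a b : A) :
    B.D₀ (Pi.single i (a ⊗ₜ op b)) = a * B.v₀ i * b := by
  rw [D₀, Fintype.linearCombination_apply_single, tmul_op_smul]

theorem D₁_single_inl (p : Fin x) (a b : A) : B.D₁ (Pi.single (Sum.inl p) (a ⊗ₜ op b)) =
    Pi.single TwoVertex.one ((a * B.basis (α p)) ⊗ₜ op (B.basis e₁ * b)) -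
      Pi.single TwoVertex.two ((a * B.basis e₂) ⊗ₜ op (B.basis (α p) * b)) := by
  rw [D₁, Fintype.linearCombination_apply_single, n₁, smul_sub, smul_single_eq, smul_single_eq,
    tmul_op_mul_tmul_op, tmul_op_mul_tmul_op]

theorem D₁_single_inr (q : Fin y) (a b : A) : B.D₁ (Pi.single (Sum.inr q) (a ⊗ₜ op b)) =
    Pi.single TwoVertex.two ((a * B.basis (β q)) ⊗ₜ op (B.basis e₂ * b)) -
      Pi.single TwoVertex.one ((a * B.basis e₁) ⊗ₜ op (B.basis (β q) * b)) := by
  rw [D₁, Fintype.linearCombination_apply_single, n₁, smul_sub, smul_single_eq, smul_single_eq,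
    tmul_op_mul_tmul_op, tmul_op_mul_tmul_op]

theorem D₂_single (i : Fin x × Fin y) (a b : A) : B.D₂ (Pi.single i (a ⊗ₜ op b)) =
    Pi.single (Sum.inl i.1) ((a * B.basis (β i.2)) ⊗ₜ op (B.basis e₁ * b)) +
      Pi.single (Sum.inr i.2) ((a * B.basis e₁) ⊗ₜ op (B.basis (α i.1) * b)) := by
  rw [D₂, Fintype.linearCombination_apply_single, n₂, smul_add, smul_single_eq, smul_single_eq,
    tmul_op_mul_tmul_op, tmul_op_mul_tmul_op]

instance : IsScalarTower k (A ⊗[k] Aᵐᵒᵖ) A := IsScalarTower.of_algebraMap_smul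
  algebraMap_enveloping_smul

theorem D₀_s₀ (a : A) : B.D₀ (B.s₀ a) = a := by
  rw [s₀_apply, map_add, D₀_single, D₀_single]
  simp only [v₀, ← mul_assoc, B.mul_eq, QHIndex.mul, Option.elim]
  rw [← add_mul, B.one_eq, one_mul]

theorem D₀_D₁ (t : Fin x ⊕ Fin y → A ⊗[k] Aᵐᵒᵖ) (ht : t ∈ projBimodule k B.l₁ B.r₁) :
    B.D₀ (B.D₁ t) = 0 := by
  refine eqOn_projBimodule B.basis _ _
    ((B.D₀.restrictScalars k).comp (B.D₁.restrictScalars k)) 0 ?_ ht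
  rintro (p | q) j c
  · simp only [LinearMap.comp_apply, LinearMap.coe_restrictScalars, D₁_single_inl, map_sub,
      D₀_single, v₀, ← mul_assoc, LinearMap.zero_apply]
    cases j <;> simp [l₁, r₁, B.mul_eq, QHIndex.mul]
  · simp only [LinearMap.comp_apply, LinearMap.coe_restrictScalars, D₁_single_inr, map_sub,
      D₀_single, v₀, ← mul_assoc, LinearMap.zero_apply]
    cases j <;> simp [l₁, r₁, B.mul_eq, QHIndex.mul]

theorem D₁_D₂ (t : Fin x × Fin y → A ⊗[k] Aᵐᵒᵖ) (ht : t ∈ projBimodule k B.v₂ B.v₂) :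
    B.D₁ (B.D₂ t) = 0 := by
  refine eqOn_projBimodule B.basis _ _
    ((B.D₁.restrictScalars k).comp (B.D₂.restrictScalars k)) 0 ?_ ht
  rintro ⟨p, q⟩ j c
  simp only [LinearMap.comp_apply, LinearMap.coe_restrictScalars, D₂_single, map_add,
    D₁_single_inl, D₁_single_inr, ← mul_assoc, LinearMap.zero_apply, v₂]
  cases j <;> simp [B.mul_eq, QHIndex.mul]

theorem homotopy₀ (t : TwoVertex x y → A ⊗[k] Aᵐᵒᵖ) (ht : t ∈ projBimodule k B.v₀ B.v₀) :
    B.D₁ (B.s₁ t) + B.s₀ (B.D₀ t) = t := by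
  refine eqOn_projBimodule B.basis _ _
    ((B.D₁.restrictScalars k).comp B.s₁ + B.s₀.comp (B.D₀.restrictScalars k)) LinearMap.id ?_ ht
  rintro (_ | _) j c <;> cases j <;>
  simp [-op_mul, v₀, h₁, B.mul_eq, QHIndex.mul, s₁_single, put_apply, D₁_single_inl,
    D₁_single_inr, D₀_single, s₀_apply, ← mul_assoc]

theorem homotopy₁ (t : Fin x ⊕ Fin y → A ⊗[k] Aᵐᵒᵖ) (ht : t ∈ projBimodule k B.l₁ B.r₁) :
    B.D₂ (B.s₂ t) + B.s₁ (B.D₁ t) = t := by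
  refine eqOn_projBimodule B.basis _ _
    ((B.D₂.restrictScalars k).comp B.s₂ + B.s₁.comp (B.D₁.restrictScalars k)) LinearMap.id ?_ ht
  rintro (_ | _) j c <;> cases j <;>
  simp [-op_mul, l₁, r₁, h₁, h₂, B.mul_eq, QHIndex.mul, s₁_single, put_apply, D₁_single_inl,
    D₁_single_inr, s₂_single_inl, s₂_single_inr, D₂_single, ← mul_assoc]

theorem homotopy₂ (t : Fin x × Fin y → A ⊗[k] Aᵐᵒᵖ) (ht : t ∈ projBimodule k B.v₂ B.v₂) :
    B.s₂ (B.D₂ t) = t := by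
  refine eqOn_projBimodule B.basis _ _ (B.s₂.comp (B.D₂.restrictScalars k)) LinearMap.id ?_ ht
  rintro ⟨p, q⟩ j c
  cases j <;> simp [-op_mul, v₂, h₂, B.mul_eq, QHIndex.mul, D₂_single, s₂_single_inl,
    s₂_single_inr, put_apply, ← mul_assoc]

end QHBasis

/-! ### From resolutions of modules to the derived category. -/

/-- Morphisms in the derived category from a module with a projective resolution of length two
for which the second coboundary vanishes. -/
theorem ModuleCat.finrank_hom_shift_of_resolution {k : Type u} [Field k] {R : Type u} [Ring R]
    [Algebra k R] [HasDerivedCategory (ModuleCat.{u} R)] {P₀ P₁ P₂ : Type u}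
    [AddCommGroup P₀] [Module R P₀] [Module.Projective R P₀]
    [AddCommGroup P₁] [Module R P₁] [Module.Projective R P₁]
    [AddCommGroup P₂] [Module R P₂] [Module.Projective R P₂] {M Y : ModuleCat.{u} R}
    (d₀ : P₀ →ₗ[R] M) (d₁ : P₁ →ₗ[R] P₀) (d₂ : P₂ →ₗ[R] P₁) (h₀ : Function.Surjective d₀)
    (h₁ : Function.Exact d₁ d₀) (h₂ : Function.Exact d₂ d₁) (h₃ : Function.Injective d₂)
    [Module.Finite k (ModuleCat.of R P₀ ⟶ Y)] [Module.Finite k (ModuleCat.of R P₁ ⟶ Y)]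
    [Module.Finite k (ModuleCat.of R P₂ ⟶ Y)] (hd : ∀ φ : P₁ →ₗ[R] Y, φ.comp d₂ = 0) (p : ℤ) :
    let H := ((DerivedCategory.singleFunctor (ModuleCat.{u} R) 0).obj M ⟶
      ((DerivedCategory.singleFunctor (ModuleCat.{u} R) 0).obj Y)⟦p⟧)
    Module.Finite k H ∧ (Module.finrank k H : ℤ) =
      if p = 0 then (Module.finrank k (M ⟶ Y) : ℤ)
      else if p = 1 then (Module.finrank k (M ⟶ Y) : ℤ) +
        Module.finrank k (ModuleCat.of R P₁ ⟶ Y) - Module.finrank k (ModuleCat.of R P₀ ⟶ Y)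
      else if p = 2 then (Module.finrank k (ModuleCat.of R P₂ ⟶ Y) : ℤ)
      else 0 := by
  -- The resolution is cut at the kernel of `d₀` into two short exact sequences.
  let δ : P₁ →ₗ[R] LinearMap.ker d₀ := d₁.codRestrict _ h₁.apply_apply_eq_zero
  have hδ : Function.Exact d₂ δ := fun t =>
    Iff.trans (by rw [Subtype.ext_iff]; rfl) (h₂ t)
  let S : ShortComplex (ModuleCat.{u} R) := d₀.shortComplexKer
  have hS : S.ShortExact := LinearMap.shortExact_shortComplexKer h₀
  let T : ShortComplex (ModuleCat.{u} R) :=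
    ModuleCat.shortComplexOfCompEqZero d₂ δ hδ.linearMap_comp_eq_zero
  have hT : T.ShortExact := ModuleCat.shortComplex_shortExact T hδ h₃ fun t => by
    obtain ⟨s, hs⟩ := (h₁ t.1).1 t.2
    exact ⟨s, Subtype.ext hs⟩
  have q₀ : Projective S.X₂ := ModuleCat.projective_of_categoryTheory_projective _
  have q₁ : Projective T.X₂ := ModuleCat.projective_of_categoryTheory_projective _
  have q₂ : Projective T.X₁ := ModuleCat.projective_of_categoryTheory_projective _
  have f₀ : Module.Finite k (S.X₂ ⟶ Y) := ‹Module.Finite k (ModuleCat.of R P₀ ⟶ Y)›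
  have f₁ : Module.Finite k (T.X₂ ⟶ Y) := ‹Module.Finite k (ModuleCat.of R P₁ ⟶ Y)›
  have f₂ : Module.Finite k (T.X₁ ⟶ Y) := ‹Module.Finite k (ModuleCat.of R P₂ ⟶ Y)›
  exact Abelian.Ext.finrank_hom_shift_of_resolution (k := k) hS hT (Iso.refl _) Y
    (fun f => ModuleCat.hom_ext (hd f.hom)) p

/-- By `hn`, `f i • n i = n i`, so multiplying coefficients by `f i` changes nothing. The homotopies
take values in free modules; this allows those values to be projected into the idempotent summands
without altering their images under the differentials. -/
theorem linearCombination_proj {R : Type*} [Ring R] {ι : Type*} [Fintype ι] [DecidableEq ι]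
    {f : ι → R} (hf : ∀ i, f i * f i = f i) {M : Type*} [AddCommGroup M] [Module R M] (n : ι → M)
    (hn : ∀ i, Fintype.linearCombination R n (Pi.single i (f i)) = n i) (t : ι → R) :
    Fintype.linearCombination R n (idempotentModule.proj hf t).1 =
      Fintype.linearCombination R n t := by
  simp only [Fintype.linearCombination_apply]
  refine Finset.sum_congr rfl fun i _ => ?_
  change (t i * f i) • n i = _
  rw [mul_smul, ← Fintype.linearCombination_apply_single R n i (f i), hn]

/-! ### Exactness, vanishing of the second coboundary, dimensions of the corners. -/

namespace QHBasis

variable {k : Type u} [Field k] {A : Type u} [Ring A] [Algebra k A] {x y : ℕ} (B : QHBasis k A x y)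

attribute [local instance] instModuleTensorProductMop

open QHIndex

theorem envelopingIdempotent_mul {ι : Type} {l r : ι → A} (hl : ∀ i, l i * l i = l i)
    (hr : ∀ i, r i * r i = r i) (i : ι) :
    envelopingIdempotent k l r i * envelopingIdempotent k l r i = envelopingIdempotent k l r i := by
  rw [tmul_op_mul_tmul_op, hl, hr]

/-- The augmentation of the bimodule resolution. -/
def d₀ : projBimodule k B.v₀ B.v₀ →ₗ[A ⊗[k] Aᵐᵒᵖ] A :=
  projBimodule.desc B.v₀ B.v₀ B.v₀

/-- The first differential of the bimodule resolution. -/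
def d₁ : projBimodule k B.l₁ B.r₁ →ₗ[A ⊗[k] Aᵐᵒᵖ] projBimodule k B.v₀ B.v₀ :=
  idempotentModule.map _ _ B.n₁ B.n₁_mem

/-- The second differential of the bimodule resolution. -/
def d₂ : projBimodule k B.v₂ B.v₂ →ₗ[A ⊗[k] Aᵐᵒᵖ] projBimodule k B.l₁ B.r₁ :=
  idempotentModule.map _ _ B.n₂ B.n₂_mem

theorem d₀_apply (t : projBimodule k B.v₀ B.v₀) : B.d₀ t = B.D₀ t.1 := rfl

theorem coe_d₁ (t : projBimodule k B.l₁ B.r₁) : (B.d₁ t).1 = B.D₁ t.1 := rfl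

theorem coe_d₂ (t : projBimodule k B.v₂ B.v₂) : (B.d₂ t).1 = B.D₂ t.1 := rfl

theorem D₀_single_idempotent (i : TwoVertex x y) :
    B.D₀ (Pi.single i (envelopingIdempotent k B.v₀ B.v₀ i)) = B.v₀ i := by
  rw [D₀_single, v₀_mul, v₀_mul]

theorem D₁_single_idempotent (i : Fin x ⊕ Fin y) :
    B.D₁ (Pi.single i (envelopingIdempotent k B.l₁ B.r₁ i)) = B.n₁ i := by
  cases i
  · rw [D₁_single_inl]
    simp [n₁, l₁, r₁, B.mul_eq, QHIndex.mul]
  · rw [D₁_single_inr]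
    simp [n₁, l₁, r₁, B.mul_eq, QHIndex.mul]

theorem D₂_single_idempotent (i : Fin x × Fin y) :
    B.D₂ (Pi.single i (envelopingIdempotent k B.v₂ B.v₂ i)) = B.n₂ i := by
  rw [D₂_single]
  simp [n₂, v₂, B.mul_eq, QHIndex.mul]

theorem d₀_surjective : Function.Surjective B.d₀ := fun a =>
  ⟨idempotentModule.proj (envelopingIdempotent_mul B.v₀_mul B.v₀_mul) (B.s₀ a),
    (linearCombination_proj (envelopingIdempotent_mul B.v₀_mul B.v₀_mul) _ B.D₀_single_idempotent _).trans (B.D₀_s₀ a)⟩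

theorem exact_d₁_d₀ : Function.Exact B.d₁ B.d₀ := by
  intro t
  constructor
  · intro ht
    refine ⟨idempotentModule.proj (envelopingIdempotent_mul B.l₁_mul B.r₁_mul) (B.s₁ t.1), ?_⟩
    ext1
    refine (linearCombination_proj (envelopingIdempotent_mul B.l₁_mul B.r₁_mul) _
      B.D₁_single_idempotent _).trans ?_
    have h := B.homotopy₀ t.1 t.2
    rwa [← d₀_apply, ht, map_zero, add_zero] at h
  · rintro ⟨t, rfl⟩
    exact B.D₀_D₁ t.1 t.2

theorem exact_d₂_d₁ : Function.Exact B.d₂ B.d₁ := by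
  intro t
  constructor
  · intro ht
    refine ⟨idempotentModule.proj (envelopingIdempotent_mul B.v₂_mul B.v₂_mul) (B.s₂ t.1), ?_⟩
    ext1
    refine (linearCombination_proj (envelopingIdempotent_mul B.v₂_mul B.v₂_mul) _
      B.D₂_single_idempotent _).trans ?_
    have h := B.homotopy₁ t.1 t.2
    rwa [← coe_d₁, ht, Submodule.coe_zero, map_zero, add_zero] at h
  · rintro ⟨t, rfl⟩
    ext1
    exact B.D₁_D₂ t.1 t.2

theorem d₂_injective : Function.Injective B.d₂ := by
  intro s t h
  ext1
  rw [← B.homotopy₂ s.1 s.2, ← B.homotopy₂ t.1 t.2, ← coe_d₂, ← coe_d₂, h]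

theorem d₂_gen (i : Fin x × Fin y) : B.d₂ (projBimodule.gen B.v₂_mul B.v₂_mul i) =
    (B.basis (β i.2) ⊗ₜ[k] op (B.basis e₁)) • projBimodule.gen B.l₁_mul B.r₁_mul (Sum.inl i.1) +
    (B.basis e₁ ⊗ₜ[k] op (B.basis (α i.1))) •
      projBimodule.gen B.l₁_mul B.r₁_mul (Sum.inr i.2) := by
  ext1
  refine (B.D₂_single i _ _).trans ?_
  refine Eq.trans ?_
    (congrArg₂ (· + ·) (smul_single_eq _ _ (Sum.inl i.1)) (smul_single_eq _ _ (Sum.inr i.2))).symm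
  rw [tmul_op_mul_tmul_op, tmul_op_mul_tmul_op]
  simp [l₁, r₁, v₂, B.mul_eq, QHIndex.mul]

/-- Only `e₁` and the `α_p` survive right multiplication by `e₁`, and `β_q` kills both. -/
theorem β_mul_mul_e₁ (q : Fin y) (a : A) : B.basis (β q) * a * B.basis e₁ = 0 := by
  have h : (LinearMap.mulRight k (B.basis e₁)).comp (LinearMap.mulLeft k (B.basis (β q))) = 0 :=
    B.basis.ext fun j => by cases j <;> simp [B.mul_eq, QHIndex.mul]
  exact LinearMap.congr_fun h a

theorem e₁_mul_mul_α (p : Fin x) (a : A) : B.basis e₁ * a * B.basis (α p) = 0 := by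
  have h : (LinearMap.mulRight k (B.basis (α p))).comp (LinearMap.mulLeft k (B.basis e₁)) = 0 :=
    B.basis.ext fun j => by cases j <;> simp [B.mul_eq, QHIndex.mul]
  exact LinearMap.congr_fun h a

theorem comp_d₂_eq_zero (φ : projBimodule k B.l₁ B.r₁ →ₗ[A ⊗[k] Aᵐᵒᵖ] A) :
    φ.comp B.d₂ = 0 := by
  ext t
  rw [← projBimodule.sum_smul_gen B.v₂_mul B.v₂_mul t, map_sum]
  refine Finset.sum_eq_zero fun i _ => ?_
  rw [map_smul, LinearMap.comp_apply, d₂_gen, map_add, map_smul, map_smul, tmul_op_smul,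
    tmul_op_smul, β_mul_mul_e₁, e₁_mul_mul_α, add_zero, smul_zero]

/-- The map `a ↦ l a r` fixes the basis vectors indexed by `g` and kills all others, so the former
are a basis of the corner. -/
theorem finrank_corner (l r : A) {σ : Type} [Fintype σ] (g : σ → QHIndex x y)
    (hg : Function.Injective g) (h₁ : ∀ s, l * B.basis (g s) * r = B.basis (g s))
    (h₂ : ∀ j, j ∉ Set.range g → l * B.basis j * r = 0) :
    Module.finrank k (corner k l r) = Fintype.card σ := by
  have h : corner k l r = Submodule.span k (Set.range (B.basis ∘ g)) := by
    apply le_antisymm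
    · intro a ha
      rw [← mem_corner.1 ha]
      have hle : (⊤ : Submodule k A) ≤ (Submodule.span k (Set.range (B.basis ∘ g))).comap
          ((LinearMap.mulRight k r).comp (LinearMap.mulLeft k l)) := by
        rw [← B.basis.span_eq, Submodule.span_le]
        rintro _ ⟨j, rfl⟩
        change l * B.basis j * r ∈ Submodule.span k (Set.range (B.basis ∘ g))
        by_cases hj : j ∈ Set.range g
        · obtain ⟨s, rfl⟩ := hj
          rw [h₁]
          exact Submodule.subset_span ⟨s, rfl⟩
        · rw [h₂ j hj]
          exact Submodule.zero_mem _
      exact hle (Submodule.mem_top (x := a))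
    · rw [Submodule.span_le]
      rintro _ ⟨s, rfl⟩
      exact h₁ s
  rw [h]
  exact finrank_span_eq_card (B.basis.linearIndependent.comp g hg)

theorem finrank_corner_e₁_e₁ : Module.finrank k (corner k (B.basis e₁) (B.basis e₁)) = 1 := by
  refine B.finrank_corner _ _ (fun _ : Unit => e₁) (fun _ _ _ => rfl) ?_ ?_
  · simp [B.mul_eq, QHIndex.mul]
  · rintro (_ | _) <;> simp [B.mul_eq, QHIndex.mul]

theorem finrank_corner_e₂_e₂ :
    Module.finrank k (corner k (B.basis e₂) (B.basis e₂)) = x * y + 1 := by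
  refine (B.finrank_corner _ _
    (fun s : Option (Fin x × Fin y) => s.elim e₂ fun i => αβ i.1 i.2) ?_ ?_ ?_).trans (by simp)
  · rintro (_ | _) (_ | _) <;> simp [Prod.ext_iff]
  · rintro (_ | _) <;> simp [B.mul_eq, QHIndex.mul]
  · intro j hj
    cases j with
    | e₂ => exact absurd ⟨none, rfl⟩ hj
    | αβ p q => exact absurd ⟨some (p, q), rfl⟩ hj
    | _ => simp [B.mul_eq, QHIndex.mul]

theorem finrank_corner_e₂_e₁ : Module.finrank k (corner k (B.basis e₂) (B.basis e₁)) = x := by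
  refine (B.finrank_corner _ _ α (fun _ _ => QHIndex.α.inj) ?_ ?_).trans (by simp)
  · simp [B.mul_eq, QHIndex.mul]
  · rintro (_ | _) <;> simp [B.mul_eq, QHIndex.mul]

theorem finrank_corner_e₁_e₂ : Module.finrank k (corner k (B.basis e₁) (B.basis e₂)) = y := by
  refine (B.finrank_corner _ _ β (fun _ _ => QHIndex.β.inj) ?_ ?_).trans (by simp)
  · simp [B.mul_eq, QHIndex.mul]
  · rintro (_ | _) <;> simp [B.mul_eq, QHIndex.mul]

end QHBasis

/-! ### The center and its dimension. -/

section Center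

variable (k : Type u) [Field k] (A : Type u) [Ring A] [Algebra k A]

attribute [local instance] instModuleTensorProductMop

/-- The endomorphisms of the regular bimodule form the center. -/
def regularBimoduleEndEquiv :
    (regularBimodule k A ⟶ regularBimodule k A) ≃ₗ[k] Subalgebra.center k A where
  toFun φ :=
    let ψ : A →ₗ[A ⊗[k] Aᵐᵒᵖ] A := φ.hom
    ⟨ψ 1, Subalgebra.mem_center_iff.2 fun a => by
      have h₁ := map_smul ψ (a ⊗ₜ op 1) 1
      have h₂ := map_smul ψ (1 ⊗ₜ op a) 1
      simp only [tmul_op_smul, mul_one, one_mul] at h₁ h₂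
      rw [← h₁, ← h₂]⟩
  map_add' φ ψ := rfl
  map_smul' c φ := by
    ext
    exact algebraMap_enveloping_smul c _
  invFun c := ModuleCat.ofHom
    { toFun := fun a : A => a * c.1
      map_add' := fun a b => add_mul _ _ _
      map_smul' := fun t a => by
        induction t with
        | zero =>
          exact (congrArg (· * c.1) (zero_smul (A ⊗[k] Aᵐᵒᵖ) a)).trans
            ((zero_mul _).trans (zero_smul (A ⊗[k] Aᵐᵒᵖ) (a * c.1)).symm)
        | add s t hs ht =>
          simp only [RingHom.id_apply] at hs ht ⊢
          simp only [add_smul, add_mul, hs, ht]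
        | tmul b d =>
          have h := tmul_op_smul (k := k) b d.unop
          rw [op_unop] at h
          rw [h, RingHom.id_apply, h, mul_assoc _ _ c.1, Subalgebra.mem_center_iff.1 c.2,
            ← mul_assoc, ← mul_assoc] }
  left_inv φ := by
    ext a
    let ψ : A →ₗ[A ⊗[k] Aᵐᵒᵖ] A := φ.hom
    change a * ψ 1 = ψ a
    have h₁ := map_smul ψ (a ⊗ₜ op 1) 1
    simp only [tmul_op_smul, mul_one] at h₁
    exact h₁.symm
  right_inv c := by
    ext
    exact one_mul _

end Center

namespace QHBasis

variable {k : Type u} [Field k] {A : Type u} [Ring A] [Algebra k A] {x y : ℕ} (B : QHBasis k A x y)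

open QHIndex

theorem mem_center_iff (a : A) :
    a ∈ Subalgebra.center k A ↔ ∀ j, B.basis j * a = a * B.basis j := by
  rw [Subalgebra.mem_center_iff]
  refine ⟨fun h j => h _, fun h b => ?_⟩
  have : LinearMap.mulRight k a = LinearMap.mulLeft k a := B.basis.ext fun j => h j
  exact LinearMap.congr_fun this b

/-- Extracts coordinates of `a` from products with paths; comparing two such products constrains the
coordinates of a central element. -/
theorem coord_mul_mul (l r : A) (i j : QHIndex x y)
    (h : ∀ m, B.basis.repr (l * B.basis m * r) i = B.basis.repr (B.basis m) j) (a : A) :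
    B.basis.repr (l * a * r) i = B.basis.repr a j := by
  have : (B.basis.coord i).comp ((LinearMap.mulRight k r).comp (LinearMap.mulLeft k l)) =
    B.basis.coord j := B.basis.ext fun m => h m
  exact LinearMap.congr_fun this a

theorem repr_α_of_mem_center {a : A} (ha : a ∈ Subalgebra.center k A) (p : Fin x) :
    B.basis.repr a (α p) = 0 := by
  rw [← B.coord_mul_mul (B.basis e₂) (B.basis e₁) (α p) (α p) fun m => by
    cases m <;> simp [B.mul_eq, QHIndex.mul], (B.mem_center_iff a).1 ha, mul_assoc, B.mul_eq]
  simp [QHIndex.mul]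

theorem repr_β_of_mem_center {a : A} (ha : a ∈ Subalgebra.center k A) (q : Fin y) :
    B.basis.repr a (β q) = 0 := by
  rw [← B.coord_mul_mul (B.basis e₁) (B.basis e₂) (β q) (β q) fun m => by
    cases m <;> simp [B.mul_eq, QHIndex.mul], (B.mem_center_iff a).1 ha, mul_assoc, B.mul_eq]
  simp [QHIndex.mul]

/-- For an arrow `α`, the `α`-coordinate of `α a` is the `e₁`-coordinate of `a`, and that of `a α`
is its `e₂`-coordinate. For an arrow `β` the roles are exchanged. -/
theorem repr_e₂_of_mem_center (h : 1 ≤ x + y) {a : A} (ha : a ∈ Subalgebra.center k A) :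
    B.basis.repr a e₂ = B.basis.repr a e₁ := by
  obtain hx | hy : 0 < x ∨ 0 < y := by omega
  · rw [← B.coord_mul_mul (B.basis (α ⟨0, hx⟩)) 1 (α ⟨0, hx⟩) e₁ fun m => by
        cases m <;> simp [B.mul_eq, QHIndex.mul],
      ← B.coord_mul_mul 1 (B.basis (α ⟨0, hx⟩)) (α ⟨0, hx⟩) e₂ fun m => by
        cases m <;> simp [B.mul_eq, QHIndex.mul],
      (B.mem_center_iff a).1 ha, one_mul, mul_one]
  · rw [← B.coord_mul_mul (B.basis (β ⟨0, hy⟩)) 1 (β ⟨0, hy⟩) e₂ fun m => by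
        cases m <;> simp [B.mul_eq, QHIndex.mul],
      ← B.coord_mul_mul 1 (B.basis (β ⟨0, hy⟩)) (β ⟨0, hy⟩) e₁ fun m => by
        cases m <;> simp [B.mul_eq, QHIndex.mul],
      (B.mem_center_iff a).1 ha, one_mul, mul_one]

theorem αβ_mem_center (p : Fin x) (q : Fin y) :
    B.basis (αβ p q) ∈ Subalgebra.center k A := by
  rw [B.mem_center_iff]
  intro j
  cases j <;> simp [B.mul_eq, QHIndex.mul]

theorem finrank_center (B : QHBasis k A x y) (h : 1 ≤ x + y) :
    Module.finrank k (Subalgebra.center k A) = x * y + 1 := by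
  -- The coordinates at `e₁` and at the `α_p β_q` are free on the center and determine the rest.
  let F : Subalgebra.center k A →ₗ[k] (Option (Fin x × Fin y) → k) :=
    (LinearMap.pi fun s : Option (Fin x × Fin y) =>
      B.basis.coord (s.elim e₁ fun i => αβ i.1 i.2)).comp (Subalgebra.center k A).val.toLinearMap
  have F_apply (a : Subalgebra.center k A) (s : Option (Fin x × Fin y)) : F a s =
    B.basis.repr ((Subalgebra.center k A).val a) (s.elim e₁ fun i => αβ i.1 i.2) := rfl
  have hF : Function.Bijective F := by
    constructor
    · rw [injective_iff_map_eq_zero]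
      rintro ⟨a, ha⟩ h0
      ext1
      refine B.basis.ext_elem fun j => ?_
      have h1 : B.basis.repr a e₁ = 0 := congrFun h0 none
      have h2 (p : Fin x) (q : Fin y) : B.basis.repr a (αβ p q) = 0 := congrFun h0 (some (p, q))
      cases j with
      | e₁ => simpa using h1
      | e₂ => simpa [B.repr_e₂_of_mem_center h ha] using h1
      | α p => simpa using B.repr_α_of_mem_center ha p
      | β q => simpa using B.repr_β_of_mem_center ha q
      | αβ p q => simpa using h2 p q
    · intro c
      refine ⟨c none • 1 + ∑ i : Fin x × Fin y, c (some i) • ⟨_, B.αβ_mem_center i.1 i.2⟩, ?_⟩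
      ext s
      rw [F_apply, map_add, map_smul, map_sum, map_one, ← B.one_eq]
      simp only [map_smul, map_add, map_sum, Subalgebra.coe_val, Module.Basis.repr_self,
        Finsupp.add_apply, Finsupp.smul_apply, Finsupp.finsetSum_apply]
      cases s with
      | none => simp
      | some i =>
        rw [Finset.sum_eq_single i]
        · simp
        · intro j _ hj
          have : αβ j.1 j.2 ≠ αβ i.1 i.2 := fun he => hj (Prod.ext (αβ.inj he).1 (αβ.inj he).2)
          simp [this]
        · simp
  rw [(LinearEquiv.ofBijective F hF).finrank_eq]
  simp

end QHBasis

/-- Without arrows the algebra is spanned by two orthogonal idempotents, hence commutative. -/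
theorem QHBasis.finrank_center_zero {k : Type u} [Field k] {A : Type u} [Ring A] [Algebra k A]
    (B : QHBasis k A 0 0) : Module.finrank k (Subalgebra.center k A) = 2 := by
  have h : Subalgebra.center k A = ⊤ := by
    refine eq_top_iff.2 fun a _ => (B.mem_center_iff a).2 fun j => ?_
    have : LinearMap.mulLeft k (B.basis j) = LinearMap.mulRight k (B.basis j) :=
      B.basis.ext fun i => by
        match i, j with
        | .e₁, .e₁ | .e₂, .e₂ => rfl
        | .e₁, .e₂ | .e₂, .e₁ => simp [B.mul_eq, QHIndex.mul]
    exact LinearMap.congr_fun this a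
  rw [h, (Subalgebra.topEquiv (R := k) (A := A)).toLinearEquiv.finrank_eq,
    Module.finrank_eq_card_basis B.basis]
  rfl

/-! ### Assembly of the Hochschild dimensions. -/

namespace QHBasis

variable {k : Type u} [Field k] {A : Type u} [Ring A] [Algebra k A] {x y : ℕ} (B : QHBasis k A x y)

open QHIndex

attribute [local instance] instModuleTensorProductMop

attribute [local instance] HasDerivedCategory.standard

/-- Hochschild cohomology in terms of the dimension of the center. -/
theorem finrank_hochschildCohomology (B : QHBasis k A x y) (p : ℤ) :
    Module.Finite k (HochschildCohomology k A p) ∧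
      (Module.finrank k (HochschildCohomology k A p) : ℤ) =
      if p = 0 then (Module.finrank k (Subalgebra.center k A) : ℤ)
      else if p = 1 then (Module.finrank k (Subalgebra.center k A) : ℤ) + (x * x + y * y)
        - (x * y + 2)
      else if p = 2 then (x : ℤ) * y
      else 0 := by
  have : Module.Finite k A := Module.Finite.of_basis B.basis
  let E₀ := projBimoduleHomEquiv (k := k) B.v₀_mul B.v₀_mul
  let E₁ := projBimoduleHomEquiv (k := k) B.l₁_mul B.r₁_mul
  let E₂ := projBimoduleHomEquiv (k := k) B.v₂_mul B.v₂_mul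
  have c₀ := E₀.finrank_eq
  have c₁ := E₁.finrank_eq
  have c₂ := E₂.finrank_eq
  have f₀ := Module.Finite.equiv E₀.symm
  have f₁ := Module.Finite.equiv E₁.symm
  have f₂ := Module.Finite.equiv E₂.symm
  have u : (Finset.univ : Finset (TwoVertex x y)) = {TwoVertex.one, TwoVertex.two} := rfl
  have p₀ := idempotentModule.projective (envelopingIdempotent_mul (k := k) B.v₀_mul B.v₀_mul)
  have p₁ := idempotentModule.projective (envelopingIdempotent_mul (k := k) B.l₁_mul B.r₁_mul)
  have p₂ := idempotentModule.projective (envelopingIdempotent_mul (k := k) B.v₂_mul B.v₂_mul)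
  have g₀ : Module.finrank k (corner k (B.v₀ .one) (B.v₀ .one)) = 1 := B.finrank_corner_e₁_e₁
  have g₁ : Module.finrank k (corner k (B.v₀ .two) (B.v₀ .two)) = x * y + 1 :=
    B.finrank_corner_e₂_e₂
  have g₂ (p : Fin x) : Module.finrank k (corner k (B.l₁ (.inl p)) (B.r₁ (.inl p))) = x :=
    B.finrank_corner_e₂_e₁
  have g₃ (q : Fin y) : Module.finrank k (corner k (B.l₁ (.inr q)) (B.r₁ (.inr q))) = y :=
    B.finrank_corner_e₁_e₂
  have g₄ (i : Fin x × Fin y) : Module.finrank k (corner k (B.v₂ i) (B.v₂ i)) = 1 :=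
    B.finrank_corner_e₁_e₁
  -- The Hom spaces out of `P₀`, `P₁`, `P₂` have dimensions `1 + (xy + 1)`, `x·x + y·y` and `xy`.
  rw [Module.finrank_pi_fintype, u, Finset.sum_pair (by simp), g₀, g₁] at c₀
  simp only [Module.finrank_pi_fintype, Fintype.sum_sum_type, g₂, g₃, Finset.sum_const,
    Finset.card_univ, Fintype.card_fin, smul_eq_mul] at c₁
  simp only [Module.finrank_pi_fintype, g₄, Finset.sum_const, Finset.card_univ,
    Fintype.card_prod, Fintype.card_fin, smul_eq_mul, mul_one] at c₂
  have key := ModuleCat.finrank_hom_shift_of_resolution (k := k) (M := regularBimodule k A)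
    (Y := regularBimodule k A) (P₀ := projBimodule k B.v₀ B.v₀) (P₁ := projBimodule k B.l₁ B.r₁)
    (P₂ := projBimodule k B.v₂ B.v₂) (by exact B.d₀) (by exact B.d₁) (by exact B.d₂)
    B.d₀_surjective B.exact_d₁_d₀ B.exact_d₂_d₁ B.d₂_injective (fun φ => B.comp_d₂_eq_zero φ) p
  rw [c₀, c₁, c₂, (regularBimoduleEndEquiv k A).finrank_eq] at key
  refine ⟨key.1, key.2.trans ?_⟩
  push_cast
  split_ifs <;> ring

end QHBasis

/-! ### Reduction of paths to basis indices. -/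

namespace QHIndex

variable {x y : ℕ}

/-- The index of a trivial path. -/
def vertex : TwoVertex x y → QHIndex x y
  | .one => e₁
  | .two => e₂

/-- The index of an arrow. -/
def arrow {a b : TwoVertex x y} : (a ⟶ b) → QHIndex x y
  | TwoArrow.α p => α p
  | TwoArrow.β q => β q

/-- The index of a path, which is `none` if the path is zero in `B(x, y)`. -/
def ofPath {a : TwoVertex x y} : {b : TwoVertex x y} → Quiver.Path a b → Option (QHIndex x y)
  | _, .nil => some (vertex a)
  | _, .cons p e => (ofPath p).bind (mul (arrow e))

/-- Associativity of the multiplication table, `none` being absorbing; it makes the reduction of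
paths compatible with composition. -/
theorem mul_bind_mul (i j l : QHIndex x y) :
    (mul j l).bind (mul i) = (mul i j).bind fun m => mul m l := by
  cases i <;> cases j <;> cases l <;> rfl

theorem arrow_mul_bind_vertex : ∀ {a b : TwoVertex x y} (e : a ⟶ b) (i : QHIndex x y),
    (mul (arrow e) i).bind (mul (vertex b)) = mul (arrow e) i
  | _, _, TwoArrow.α _, i => by cases i <;> rfl
  | _, _, TwoArrow.β _, i => by cases i <;> rfl

theorem vertex_mul_ofPath {a b : TwoVertex x y} (p : Quiver.Path a b) :
    (ofPath p).bind (mul (vertex b)) = ofPath p := by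
  cases p with
  | nil => cases a <;> rfl
  | cons p e =>
    rw [ofPath]
    cases ofPath p with
    | none => rfl
    | some i => exact arrow_mul_bind_vertex e i

theorem ofPath_mul_vertex {a b : TwoVertex x y} (p : Quiver.Path a b) :
    ((ofPath p).bind fun i => mul i (vertex a)) = ofPath p := by
  induction p with
  | nil => cases a <;> rfl
  | cons p e ih =>
    rw [ofPath]
    revert ih
    cases ofPath p with
    | none => exact fun _ => rfl
    | some i =>
      intro ih
      change (mul (arrow e) i).bind (fun m => mul m (vertex a)) = mul (arrow e) i
      rw [← mul_bind_mul]
      exact congrArg (fun o => Option.bind o (mul (arrow e))) ih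

theorem ofPath_comp {a b c : TwoVertex x y} (p : Quiver.Path a b) (q : Quiver.Path b c) :
    ofPath (p.comp q) = (ofPath q).bind fun i => (ofPath p).bind (mul i) := by
  induction q with
  | nil => exact (vertex_mul_ofPath p).symm
  | cons q e ih =>
    rw [Quiver.Path.comp_cons, ofPath, ih, ofPath]
    cases ofPath q with
    | none => rfl
    | some i =>
      cases ofPath p with
      | none => exact (Option.bind_fun_none _).symm
      | some j => exact mul_bind_mul _ _ _

/-- Insert the vertex idempotents at `c` and `b` between the two factors; for `b ≠ c` they are
orthogonal. -/
theorem ofPath_bind_mul_of_ne {a b c d : TwoVertex x y} (p : Quiver.Path c d)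
    (q : Quiver.Path a b) (h : b ≠ c) :
    ((ofPath p).bind fun i => (ofPath q).bind (mul i)) = none := by
  have hp := ofPath_mul_vertex p
  have hq := vertex_mul_ofPath q
  revert hp hq
  cases ofPath p with
  | none => exact fun _ _ => rfl
  | some i =>
    cases ofPath q with
    | none => exact fun _ _ => rfl
    | some j =>
      intro hp hq
      change mul i (vertex c) = some i at hp
      change mul (vertex b) j = some j at hq
      change mul i j = none
      have h' : mul (vertex c) (vertex b) = none := by
        cases b <;> cases c <;> first | rfl | exact absurd rfl h
      have h₁ := mul_bind_mul i (vertex c) j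
      have h₂ := mul_bind_mul (vertex c) (vertex b) j
      rw [hp] at h₁
      rw [hq, h'] at h₂
      change mul (vertex c) j = none at h₂
      rw [h₂] at h₁
      exact h₁.symm

/-- The element of the path algebra with a given index. -/
def toPathAlgebra (k : Type u) [Field k] : QHIndex x y → PathAlgebra k (TwoVertex x y)
  | e₁ => PathAlgebra.ofPath k (Quiver.Path.nil : Quiver.Path TwoVertex.one TwoVertex.one)
  | e₂ => PathAlgebra.ofPath k (Quiver.Path.nil : Quiver.Path TwoVertex.two TwoVertex.two)
  | α p => QHAlgebra.pathα k x y p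
  | β q => QHAlgebra.pathβ k x y q
  | αβ p q => QHAlgebra.pathα k x y p * QHAlgebra.pathβ k x y q

end QHIndex

/-! ### The path basis of the quotient algebra. -/

namespace QHAlgebra

open QHIndex

variable (k : Type u) [Field k] (x y : ℕ)

/-- The basis vector with a given index, or zero. -/
def indexVector (o : Option (QHIndex x y)) : QHIndex x y →₀ k :=
  o.elim 0 fun i => Finsupp.single i 1

/-- The coordinates in `B(x, y)` of the elements of the path algebra. -/
def coordinates : PathAlgebra k (TwoVertex x y) →ₗ[k] (QHIndex x y →₀ k) :=
  PathAlgebra.lift fun p => indexVector k x y (QHIndex.ofPath p.2.2)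

/-- The multiplication of `B(x, y)` in coordinates. -/
def mulCoordinates : (QHIndex x y →₀ k) →ₗ[k] (QHIndex x y →₀ k) →ₗ[k] (QHIndex x y →₀ k) :=
  Finsupp.linearCombination k fun i => Finsupp.linearCombination k fun j =>
    indexVector k x y (QHIndex.mul i j)

theorem mulCoordinates_indexVector (s t : Option (QHIndex x y)) :
    mulCoordinates k x y (indexVector k x y s) (indexVector k x y t) =
      indexVector k x y (s.bind fun i => t.bind (QHIndex.mul i)) := by
  cases s <;> cases t <;> simp [mulCoordinates, indexVector]

theorem coordinates_ofPath {a b : TwoVertex x y} (p : Quiver.Path a b) :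
    coordinates k x y (PathAlgebra.ofPath k p) = indexVector k x y (QHIndex.ofPath p) :=
  PathAlgebra.lift_ofPath _ p

theorem coordinates_mul (f g : PathAlgebra k (TwoVertex x y)) :
    coordinates k x y (f * g) = mulCoordinates k x y (coordinates k x y f)
      (coordinates k x y g) := by
  induction f using PathAlgebra.induction_on with
  | zero => simp
  | add f₁ f₂ h₁ h₂ => rw [add_mul, map_add, h₁, h₂, map_add, map_add, LinearMap.add_apply]
  | smul r f hf => rw [smul_mul_assoc, map_smul, hf, map_smul, map_smul, LinearMap.smul_apply]
  | @path c d p =>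
    induction g using PathAlgebra.induction_on with
    | zero => simp
    | add f₁ f₂ h₁ h₂ => rw [mul_add, map_add, h₁, h₂, map_add, map_add]
    | smul r f hf => rw [mul_smul_comm, map_smul, hf, map_smul, map_smul]
    | @path a b q =>
      rw [coordinates_ofPath, coordinates_ofPath, mulCoordinates_indexVector]
      by_cases h : b = c
      · subst h
        rw [PathAlgebra.ofPath_mul_ofPath, coordinates_ofPath, QHIndex.ofPath_comp]
      · rw [PathAlgebra.ofPath_mul_ofPath_of_ne k _ _ h, map_zero,
          QHIndex.ofPath_bind_mul_of_ne _ _ h]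
        rfl

theorem coordinates_toPathAlgebra (i : QHIndex x y) :
    coordinates k x y (i.toPathAlgebra k) = Finsupp.single i 1 := by
  cases i with
  | αβ p q =>
    rw [toPathAlgebra, coordinates_mul]
    exact (congrArg₂ (fun s t => mulCoordinates k x y s t) (coordinates_ofPath ..)
      (coordinates_ofPath ..)).trans (mulCoordinates_indexVector ..)
  | _ => exact coordinates_ofPath ..

/-- The table has `β_q α_p = 0`, and multiplicativity carries the vanishing to the whole ideal.
Coordinates therefore depend only on the class in the quotient, which gives linear independence. -/
theorem coordinates_eq_zero {f : PathAlgebra k (TwoVertex x y)} (hf : f ∈ relations k x y) :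
    coordinates k x y f = 0 := by
  induction hf using TwoSidedIdeal.span_induction with
  | mem f hf =>
    obtain ⟨p, q, rfl⟩ := hf
    rw [coordinates_mul]
    exact (congrArg₂ (fun s t => mulCoordinates k x y s t) (coordinates_ofPath ..)
      (coordinates_ofPath ..)).trans (mulCoordinates_indexVector ..)
  | zero => exact map_zero _
  | add f g _ _ hf hg => rw [map_add, hf, hg, add_zero]
  | neg f _ hf => rw [map_neg, hf, neg_zero]
  | left_absorb f g _ hg => rw [coordinates_mul, hg, map_zero]
  | right_absorb f g _ hf => rw [coordinates_mul, hf, map_zero, LinearMap.zero_apply]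

/-- The projection from the path algebra to `B(x, y)`. -/
def proj : PathAlgebra k (TwoVertex x y) →ₐ[k] QHAlgebra k x y :=
  (relations k x y).ringCon.mkₐ k

theorem proj_surjective : Function.Surjective (proj k x y) :=
  RingCon.mkₐ_surjective _

theorem proj_eq_zero_iff (f : PathAlgebra k (TwoVertex x y)) :
    proj k x y f = 0 ↔ f ∈ relations k x y :=
  (RingCon.eq _).trans (TwoSidedIdeal.mem_iff _ _).symm

/-- The images in `B(x, y)` of the basis paths. -/
def basisVector (i : QHIndex x y) : QHAlgebra k x y := proj k x y (i.toPathAlgebra k)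

theorem proj_β_mul_α (p : Fin x) (q : Fin y) :
    proj k x y (pathβ k x y q) * proj k x y (pathα k x y p) = 0 := by
  rw [← map_mul, proj_eq_zero_iff]
  exact TwoSidedIdeal.subset_span ⟨p, q, rfl⟩

theorem linearIndependent_basisVector : LinearIndependent k (basisVector k x y) := by
  rw [Fintype.linearIndependent_iff]
  intro c hc i
  have h : coordinates k x y (∑ j, c j • j.toPathAlgebra k) = 0 := by
    refine coordinates_eq_zero k x y ((proj_eq_zero_iff k x y _).1 ?_)
    rw [map_sum, ← hc]
    exact Finset.sum_congr rfl fun j _ => map_smul _ _ _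
  have h' := DFunLike.congr_fun h i
  simpa [coordinates_toPathAlgebra, Finsupp.single_apply] using h'

theorem basisVector_αβ (p : Fin x) (q : Fin y) :
    basisVector k x y (αβ p q) = basisVector k x y (α p) * basisVector k x y (β q) :=
  map_mul _ _ _

theorem proj_ofPath_mul {a b c : TwoVertex x y} (p : Quiver.Path b c) (q : Quiver.Path a b) :
    proj k x y (PathAlgebra.ofPath k p) * proj k x y (PathAlgebra.ofPath k q) =
      proj k x y (PathAlgebra.ofPath k (q.comp p)) := by
  rw [← map_mul, PathAlgebra.ofPath_mul_ofPath]

theorem proj_ofPath_mul_of_ne {a b c d : TwoVertex x y} (p : Quiver.Path c d)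
    (q : Quiver.Path a b) (h : b ≠ c) :
    proj k x y (PathAlgebra.ofPath k p) * proj k x y (PathAlgebra.ofPath k q) = 0 := by
  rw [← map_mul, PathAlgebra.ofPath_mul_ofPath_of_ne k _ _ h, map_zero]

/-- Each zero of the table has one of two causes: the paths do not compose, or a factor `β_q α_p`
appears. -/
theorem basisVector_mul (i j : QHIndex x y) : basisVector k x y i * basisVector k x y j =
    (QHIndex.mul i j).elim 0 (basisVector k x y) := by
  have hβα (q : Fin y) (p : Fin x) : basisVector k x y (β q) * basisVector k x y (α p) = 0 :=
    proj_β_mul_α k x y p q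
  match i, j with
  | e₁, e₁ | e₂, e₂ | e₁, β _ | e₂, α _ | α _, e₁ | β _, e₂ => exact proj_ofPath_mul k x y _ _
  | e₁, e₂ | e₂, e₁ | e₁, α _ | e₂, β _ | α _, e₂ | β _, e₁ | α _, α _ | β _, β _ =>
    exact proj_ofPath_mul_of_ne k x y _ _ (by simp)
  | β q, α p => exact hβα q p
  | α p, β q => exact (basisVector_αβ k x y p q).symm
  | e₁, αβ p q =>
    rw [basisVector_αβ, ← mul_assoc]
    exact (congrArg (· * _) (proj_ofPath_mul_of_ne k x y _ _ (by simp))).trans (zero_mul _)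
  | e₂, αβ p q =>
    refine Eq.trans ?_ (basisVector_αβ k x y p q).symm
    rw [basisVector_αβ, ← mul_assoc]
    exact congrArg (· * _) (proj_ofPath_mul k x y _ _)
  | α _, αβ p q =>
    rw [basisVector_αβ, ← mul_assoc]
    exact (congrArg (· * _) (proj_ofPath_mul_of_ne k x y _ _ (by simp))).trans (zero_mul _)
  | αβ p q, e₁ =>
    rw [basisVector_αβ, mul_assoc]
    exact (congrArg (_ * ·) (proj_ofPath_mul_of_ne k x y _ _ (by simp))).trans (mul_zero _)
  | αβ p q, e₂ =>
    refine Eq.trans ?_ (basisVector_αβ k x y p q).symm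
    rw [basisVector_αβ, mul_assoc]
    exact congrArg (_ * ·) (proj_ofPath_mul k x y _ _)
  | αβ p q, β _ =>
    rw [basisVector_αβ, mul_assoc]
    exact (congrArg (_ * ·) (proj_ofPath_mul_of_ne k x y _ _ (by simp))).trans (mul_zero _)
  | β q, αβ p q' =>
    rw [basisVector_αβ, ← mul_assoc, hβα, zero_mul]
    rfl
  | αβ p q, α p' =>
    rw [basisVector_αβ, mul_assoc, hβα, mul_zero]
    rfl
  | αβ p q, αβ p' q' =>
    rw [basisVector_αβ, basisVector_αβ, mul_assoc, ← mul_assoc (basisVector k x y (β q)), hβα,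
      zero_mul, mul_zero]
    rfl

theorem proj_ofPath_arrow : ∀ {a b : TwoVertex x y} (e : a ⟶ b),
    proj k x y (PathAlgebra.ofPath k e.toPath) = basisVector k x y (arrow e)
  | _, _, TwoArrow.α _ => rfl
  | _, _, TwoArrow.β _ => rfl

/-- Adding one arrow at a time, every path becomes a basis vector or zero in the quotient, whence
the spanning property. -/
theorem proj_ofPath {a b : TwoVertex x y} (p : Quiver.Path a b) :
    proj k x y (PathAlgebra.ofPath k p) =
      (QHIndex.ofPath p).elim 0 (basisVector k x y) := by
  induction p with
  | nil => cases a <;> rfl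
  | cons p e ih =>
    have h : PathAlgebra.ofPath k (p.cons e) =
        PathAlgebra.ofPath k e.toPath * PathAlgebra.ofPath k p :=
      (PathAlgebra.ofPath_mul_ofPath k e.toPath p).symm
    rw [h, map_mul, proj_ofPath_arrow, ih, QHIndex.ofPath]
    cases QHIndex.ofPath p with
    | none => exact mul_zero _
    | some i => exact basisVector_mul k x y _ _

theorem span_basisVector : ⊤ ≤ Submodule.span k (Set.range (basisVector k x y)) := by
  intro a _
  obtain ⟨f, rfl⟩ := proj_surjective k x y a
  induction f using PathAlgebra.induction_on with
  | zero => rw [map_zero]; exact Submodule.zero_mem _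
  | add f g hf hg => rw [map_add]; exact Submodule.add_mem _ (hf trivial) (hg trivial)
  | smul r f hf => rw [map_smul]; exact Submodule.smul_mem _ _ (hf trivial)
  | path p =>
    rw [proj_ofPath]
    cases QHIndex.ofPath p with
    | none => exact Submodule.zero_mem _
    | some i => exact Submodule.subset_span ⟨i, rfl⟩

/-- The basis of `B(x, y)` given by paths. -/
def qhBasis : QHBasis k (QHAlgebra k x y) x y where
  basis := Module.Basis.mk (linearIndependent_basisVector k x y) (span_basisVector k x y)
  mul_eq i j := by
    simp only [Module.Basis.mk_apply, basisVector_mul]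
    cases QHIndex.mul i j <;> simp
  one_eq := by
    simp only [Module.Basis.mk_apply]
    rw [basisVector, basisVector, ← map_add, ← map_one (proj k x y)]
    congr 1
    exact (Finset.sum_pair (show (TwoVertex.one : TwoVertex x y) ≠ .two by simp)
      (f := fun a => PathAlgebra.ofPath k (Quiver.Path.nil : Quiver.Path a a))).symm

end QHAlgebra

theorem corollaryc (k : Type u) [Field k] :
    (∀ x y : ℕ, 1 ≤ x + y → ∀ p : ℤ,
      Module.Finite k (HochschildCohomology k (QHAlgebra k x y) p) ∧
      (Module.finrank k (HochschildCohomology k (QHAlgebra k x y) p) : ℤ) =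
        if p = 0 then (x : ℤ) * y + 1
        else if p = 1 then (x : ℤ) ^ 2 + (y : ℤ) ^ 2 - 1
        else if p = 2 then (x : ℤ) * y
        else 0) ∧
    (∀ p : ℤ,
      Module.Finite k (HochschildCohomology k (QHAlgebra k 0 0) p) ∧
      (Module.finrank k (HochschildCohomology k (QHAlgebra k 0 0) p) : ℤ) =
        if p = 0 then 2 else 0) := by
  refine ⟨fun x y h p => ?_, fun p => ?_⟩
  · have key := (QHAlgebra.qhBasis k x y).finrank_hochschildCohomology p
    rw [(QHAlgebra.qhBasis k x y).finrank_center h] at key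
    refine ⟨key.1, key.2.trans ?_⟩
    push_cast
    split_ifs <;> ring
  · have key := (QHAlgebra.qhBasis k 0 0).finrank_hochschildCohomology p
    rw [(QHAlgebra.qhBasis k 0 0).finrank_center_zero] at key
    refine ⟨key.1, key.2.trans ?_⟩
    push_cast
    split_ifs <;> simp

end
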